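/- Let $\mathcal R$ be the set of Radon point measures on $(0,\infty)$ (countable sums of Dirac masses that are finite on compact subsets of $(0,\infty)$), equipped with the topology of vague convergence and its Borel $\sigma$-algebra, let $\mathbf 0$ be the null measure, and let $\mathcal D\subset\mathcal R$ be the subset of measures with bounded support (identified with the nonincreasing sequences of nonnegative reals that converge to $0$). Let $X=(X(t),t\ge 0)$ be a time-homogeneous, jointly measurable $\mathcal R$-valued Markov process, write $X^{(\mathbf u)}$ for a version of $X$ starting from $\mathbf u$, and suppose that $X$ has the superposition property: for all $\mathbf u,\mathbf v\in\mathcal R$, the sum of independent processes $X^{(\mathbf u)}$ and $X^{(\mathbf v)}$ is distributed as the process $X^{(\mathbf u+\mathbf v)}$. Let $I$ be a $\sigma$-finite measure on $\mathcal R$, let $((\mathbf s(t_i),t_i))_i$ be the atoms of a Poisson measure on $\mathcal R\times[0,\infty)$ with intensity $I(d\mathbf s)\,dt$ and, conditionally on this Poisson measure, let $X^{(\mathbf s(t_i))}$ be independent versions of $X$ starting respectively from the $\mathbf s(t_i)$. Suppose that almost surely $\sum_{t_i\le t}X^{(\mathbf s(t_i))}(t-t_i)\in\mathcal R$ for all $t\ge0$.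 For a random $\mathbf u\in\mathcal R$, the $X$-process with immigration starting from $\mathbf u$ is $$XI^{(\mathbf u)}(t)=X^{(\mathbf u)}(t)+\sum_{v_i\le t}X^{(\mathbf r(v_i))}(t-v_i),\qquad t\ge 0,$$ where $((X^{(\mathbf r(v_i))},v_i))_i$ is a version of $((X^{(\mathbf s(t_i))},t_i))_i$ independent of $X^{(\mathbf u)}$. A stationary distribution for $XI$ is a probability measure $\pi$ on $\mathcal R$ such that, if $\mathbf u$ has law $\pi$, then $XI^{(\mathbf u)}(t)$ has law $\pi$ for every $t\ge0$; it is a stationary distribution on $\mathcal D$ if moreover $\pi(\mathcal D)=1$. Let $$\mathbf U_{\rm stat}=\sum_i X^{(\mathbf s(t_i))}(t_i).$$ (i) If $\mathbf U_{\rm stat}\in\mathcal R$ almost surely, then the law of $\mathbf U_{\rm stat}$ is a stationary distribution for $XI$ and, for any random $\mathbf u\in\mathcal R$ such that $X^{(\mathbf u)}(t)\to\mathbf 0$ in probability as $t\to\infty$, $XI^{(\mathbf u)}(t)$ converges in law to $\mathbf U_{\rm stat}$ as $t\to\infty$. (ii) If $P(\mathbf U_{\rm stat}\notin\mathcal R)>0$,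 then there exists no stationary distribution for $XI$; and if $P(\mathbf U_{\rm stat}\notin\mathcal D)>0$, then there exists no stationary distribution on $\mathcal D$ for $XI$. -/

import Mathlib

open MeasureTheory ProbabilityTheory Filter Topology
open scoped NNReal ENNReal

noncomputable section

namespace Immigration

/-- The open half line of positive reals, the space on which the point measures live. -/
abbrev PosReal : Type := Set.Ioi (0 : ℝ)

/-- A point measure is a sum of countably many Dirac masses (with repetitions allowed, and
possibly without any mass at all). -/
def IsPointMeasure (m : Measure PosReal) : Prop :=
  ∃ (κ : Type) (_ : Countable κ) (x : κ → PosReal), m = Measure.sum fun k => Measure.dirac (x k)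

/-- A Radon point measure: a point measure which is finite on the compact subsets of the open
half line. -/
def IsRadonPoint (m : Measure PosReal) : Prop :=
  IsPointMeasure m ∧ ∀ K : Set PosReal, IsCompact K → m K < ∞

/-- A Radon point measure with bounded support. These measures are identified with the
nonincreasing sequences of nonnegative reals which converge to zero. -/
def IsBoundedRadonPoint (m : Measure PosReal) : Prop :=
  IsRadonPoint m ∧ ∃ b : ℝ, m {x : PosReal | b < (x : ℝ)} = 0

theorem isPointMeasure_zero : IsPointMeasure 0 := by
  refine ⟨Empty, inferInstance, fun k => k.elim, ?_⟩
  ext s hs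
  simp

theorem isRadonPoint_zero : IsRadonPoint 0 :=
  ⟨isPointMeasure_zero, fun K _ => by simp⟩

theorem IsPointMeasure.add {m m' : Measure PosReal} (h : IsPointMeasure m)
    (h' : IsPointMeasure m') : IsPointMeasure (m + m') := by
  obtain ⟨κ, hκ, x, rfl⟩ := h
  obtain ⟨κ', hκ', x', rfl⟩ := h'
  refine ⟨κ ⊕ κ', inferInstance, Sum.elim x x', ?_⟩
  ext s hs
  simp [Measure.sum_apply _ hs, ENNReal.summable.tsum_sum ENNReal.summable]

theorem IsRadonPoint.add {m m' : Measure PosReal} (h : IsRadonPoint m)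
    (h' : IsRadonPoint m') : IsRadonPoint (m + m') :=
  ⟨h.1.add h'.1, fun K hK => by
    simpa using ENNReal.add_lt_top.2 ⟨h.2 K hK, h'.2 K hK⟩⟩

/-- The set of Radon point measures on the open half line. -/
structure RadonPointMeasure : Type where
  toMeasure : Measure PosReal
  isRadonPoint : IsRadonPoint toMeasure

namespace RadonPointMeasure

instance : Zero RadonPointMeasure := ⟨⟨0, isRadonPoint_zero⟩⟩

instance : Add RadonPointMeasure :=
  ⟨fun u v => ⟨u.toMeasure + v.toMeasure, u.isRadonPoint.add v.isRadonPoint⟩⟩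

/-- The topology of vague convergence: the coarsest topology for which the integral of every
continuous function with compact support is continuous. -/
instance : TopologicalSpace RadonPointMeasure :=
  TopologicalSpace.induced
    (fun u (φ : CompactlySupportedContinuousMap PosReal ℝ) => ∫ x, φ x ∂u.toMeasure) inferInstance

instance : MeasurableSpace RadonPointMeasure := borel RadonPointMeasure

instance : BorelSpace RadonPointMeasure := ⟨rfl⟩

open Classical in
/-- A measure seen as a Radon point measure. It is only of interest for measures which are Radon
point measures; all others are sent to zero. -/
def ofMeasure (m : Measure PosReal) : RadonPointMeasure :=
  if h : IsRadonPoint m then ⟨m, h⟩ else 0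

end RadonPointMeasure

/-- A time-homogeneous Markov process in the space of Radon point measures, on a measurable space
`W` that carries the process, together with the family of laws `law u` under which the process
starts from `u`. The process is jointly measurable in time and randomness, so that it can be
evaluated at random times. -/
structure MarkovProcess (W : Type*) [MeasurableSpace W] where
  /-- the process -/
  proc : ℝ≥0 → W → RadonPointMeasure
  /-- the law on `W` under which the process starts from a given point -/
  law : Kernel RadonPointMeasure W
  isMarkovKernel_law : IsMarkovKernel law
  measurable_proc : Measurable fun p : ℝ≥0 × W => proc p.1 p.2
  start : ∀ u, ∀ᵐ w ∂(law u), proc 0 w = u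
  /-- the Markov property with respect to the filtration generated by the process -/
  markov : ∀ (u : RadonPointMeasure) (s t : ℝ≥0) (B : Set W) (A : Set RadonPointMeasure),
    MeasurableSet[⨆ r : Set.Iic s, MeasurableSpace.comap (proc r) inferInstance] B →
    MeasurableSet A →
    law u (B ∩ {w | proc (s + t) w ∈ A}) = ∫⁻ w in B, law (proc s w) {w' | proc t w' ∈ A} ∂(law u)

namespace MarkovProcess

attribute [instance] MarkovProcess.isMarkovKernel_law

variable {W : Type*} [MeasurableSpace W] (X : MarkovProcess W)

/-- The superposition property: the sum of two independent processes which start from `u` and `v`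
has the same law, as a process, as the process which starts from `u + v`. -/
def Superposition : Prop :=
  ∀ u v : RadonPointMeasure,
    ((X.law u).prod (X.law v)).map (fun p (t : ℝ≥0) => X.proc t p.1 + X.proc t p.2) =
      (X.law (u + v)).map (fun w (t : ℝ≥0) => X.proc t w)

/-- The law on `W` under which the process starts from a random initial state with distribution
`π`. -/
abbrev lawFrom (π : Measure RadonPointMeasure) : Measure W := π.bind X.law

/-- The process which starts from a random initial state with distribution `π` converges to the
null measure in probability. -/
def TendstoZeroInProbability (π : Measure RadonPointMeasure) : Prop :=
  ∀ V ∈ 𝓝 (0 : RadonPointMeasure),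
    Tendsto (fun t : ℝ≥0 => X.lawFrom π {w | X.proc t w ∉ V}) atTop (𝓝 0)

end MarkovProcess

/-- The random point measure with atoms `a i`, `i : ι`. -/
def atomMeasure {ι Ω S : Type*} [MeasurableSpace S] (a : ι → Ω → S) (ω : Ω) : Measure S :=
  Measure.sum fun i => Measure.dirac (a i ω)

/-- The random points `a i`, `i : ι`, are the atoms of a Poisson measure with intensity `η`. -/
structure IsPoissonAtoms {ι Ω S : Type*} [MeasurableSpace Ω] [MeasurableSpace S]
    (P : Measure Ω) (η : Measure S) (a : ι → Ω → S) : Prop where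
  measurable : ∀ i, Measurable (a i)
  map_eq : ∀ A : Set S, MeasurableSet A → η A ≠ ∞ →
    P.map (fun ω => atomMeasure a ω A) =
      (poissonMeasure (η A).toNNReal).map (fun n : ℕ => (n : ℝ≥0∞))
  iIndepFun : ∀ (n : ℕ) (A : Fin n → Set S), (∀ j, MeasurableSet (A j)) →
    Pairwise (Function.onFun Disjoint A) →
    ProbabilityTheory.iIndepFun (fun j ω => atomMeasure a ω (A j)) P

/-- The points `(s i, τ i)` are the atoms of a Poisson measure with intensity `I(ds) dt` and,
conditionally on these atoms, the `ξ i` are independent versions of the process `X`, the `i`-th one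
starting from `s i`. -/
structure IsImmigration {W ι Ω : Type*} [MeasurableSpace W] [MeasurableSpace Ω]
    (X : MarkovProcess W) (I : Measure RadonPointMeasure) (P : Measure Ω)
    (s : ι → Ω → RadonPointMeasure) (τ : ι → Ω → ℝ≥0) (ξ : ι → Ω → W) : Prop where
  poisson : IsPoissonAtoms P (I.prod ((volume : Measure ℝ).comap ((↑) : ℝ≥0 → ℝ)))
    (fun i ω => (s i ω, τ i ω))
  measurable : ∀ i, Measurable (ξ i)
  cond_indep : ∀ (B : Set (ι → RadonPointMeasure × ℝ≥0)) (J : Finset ι) (A : ι → Set W),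
    MeasurableSet B → (∀ i, MeasurableSet (A i)) →
    P ({ω | (fun i => (s i ω, τ i ω)) ∈ B} ∩ {ω | ∀ i ∈ J, ξ i ω ∈ A i}) =
      ∫⁻ ω in {ω | (fun i => (s i ω, τ i ω)) ∈ B}, ∏ i ∈ J, X.law (s i ω) (A i) ∂P

section Processes

variable {W ι Ω : Type*} [MeasurableSpace W] [MeasurableSpace Ω] (X : MarkovProcess W)
  (τ : ι → Ω → ℝ≥0) (ξ : ι → Ω → W)

/-- The point measure at time `t` that stems from the immigrants up to time `t`. -/
def immigrantSum (t : ℝ≥0) (ω : Ω) : Measure PosReal :=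
  Measure.sum fun i => if τ i ω ≤ t then (X.proc (t - τ i ω) (ξ i ω)).toMeasure else 0

/-- The sum over all immigrants of the process started at the immigrant and evaluated at the
immigration time. -/
def statSum (ω : Ω) : Measure PosReal :=
  Measure.sum fun i => (X.proc (τ i ω) (ξ i ω)).toMeasure

/-- The process with immigration. Its first ingredient `p.1` is a version of `X` with the prescribed
initial state, the second one `p.2` governs the immigration; see `immigrationLaw`. -/
def immigrationProc (t : ℝ≥0) (p : W × Ω) : RadonPointMeasure :=
  RadonPointMeasure.ofMeasure ((X.proc t p.1).toMeasure + immigrantSum X τ ξ t p.2)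

/-- The probability measure under which the process with immigration starts from a random state
with distribution `π`: the version of `X` that starts from this state and the immigration are
independent. -/
abbrev immigrationLaw (P : Measure Ω) (π : Measure RadonPointMeasure) : Measure (W × Ω) :=
  (X.lawFrom π).prod P

/-- `π` is a stationary distribution for the process with immigration: when the initial state has
distribution `π`, so has the state at every time. -/
def IsStationary (P : Measure Ω) (π : Measure RadonPointMeasure) : Prop :=
  IsProbabilityMeasure π ∧
    ∀ t : ℝ≥0, (immigrationLaw X P π).map (immigrationProc X τ ξ t) = π

end Processes

end Immigration

end

/-! Laws on the space of Radon point measures are compared through their Laplace functionals E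
exp(-⟨φ, ·⟩), where φ ≥ 0 is continuous with compact support; these determine the law
(`measure_ext_of_laplace`). Write L_t(u) for the functional of X^(u)(t). The exponential formula for
marked Poisson measures gives -log E exp(-⟨φ, U_stat⟩) = ∫ I(dv) ∫_0^∞ (1 - L_r(v)) dr. For the
immigrants present at time t, the reversal r ↦ t - r of [0, t] gives the same integral over [0, t].
So at each fixed t they have the law of the part of U_stat with t_i ≤ t (`truncSum`).

Stationarity. Cut the integral at t. The part over [0, t] belongs to the immigrants. In the rest,
the Markov property L_{r+t}(v) = E L_t(X^(v)(r)) and the exponential formula, read backwards, give E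
∏ L_t(X^(s(t_i))(t_i)). This is E L_t(U_stat) once superposition is known for countably many
summands. That is the delicate point, since L_t is only known to be Borel in u. The map S ↦ -log
L_t(sum over S) is a finite, finitely additive, Borel function of the index set S, and a Baire
category argument makes every such function countably additive
(`eq_tsum_of_additive_of_measurable`).

Convergence. At a fixed time XI may be replaced by X(t) plus an independent truncated sum. The
truncated sum increases almost surely to U_stat, and X(t) tends to zero along subsequences.

Nonexistence. A stationary π dominates the immigrants present at each time, so E_π exp(-c⟨φ, u⟩) ≤ E
exp(-c⟨φ, U_stat⟩) for all c. Letting c → 0 gives π(⟨φ, u⟩ < ∞) ≤ P(⟨φ, U_stat⟩ < ∞). This is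
applied to indicators of compact sets and of (1, ∞). -/

noncomputable section

namespace Immigration

/-! ### The function `x ↦ exp (-x)` on the extended nonnegative reals -/

/-- The function `x ↦ exp (-x)`, with value `0` at infinity. -/
def negExp (x : ℝ≥0∞) : ℝ≥0∞ := EReal.exp (-(x : EReal))

/-- The inverse of `negExp` on `[0, 1]`. -/
def negLog (x : ℝ≥0∞) : ℝ≥0∞ := (-ENNReal.log x).toENNReal

@[simp] theorem negExp_zero : negExp 0 = 1 := by simp [negExp]

@[simp] theorem negExp_top : negExp ∞ = 0 := by simp [negExp]

theorem negExp_add (x y : ℝ≥0∞) : negExp (x + y) = negExp x * negExp y := by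
  unfold negExp
  rw [← EReal.exp_add, EReal.coe_ennreal_add, EReal.neg_add, sub_eq_add_neg]
  · exact Or.inl (EReal.coe_ennreal_ne_bot x)
  · exact Or.inr (EReal.coe_ennreal_ne_bot y)

theorem negExp_antitone : Antitone negExp := fun x y h => by
  simpa [negExp] using h

theorem negExp_le_one (x : ℝ≥0∞) : negExp x ≤ 1 := by
  simpa using negExp_antitone (zero_le : 0 ≤ x)

theorem negExp_ne_top (x : ℝ≥0∞) : negExp x ≠ ∞ :=
  ne_top_of_le_ne_top ENNReal.one_ne_top (negExp_le_one x)

@[simp] theorem negExp_eq_zero_iff {x : ℝ≥0∞} : negExp x = 0 ↔ x = ∞ := by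
  simp [negExp]

theorem continuous_negExp : Continuous negExp :=
  ENNReal.continuous_exp.comp (continuous_neg.comp continuous_coe_ennreal_ereal)

@[fun_prop]
theorem measurable_negExp : Measurable negExp := continuous_negExp.measurable

@[fun_prop]
theorem measurable_negLog : Measurable negLog :=
  measurable_ereal_toENNReal.comp ENNReal.measurable_log.neg

theorem negExp_negLog {x : ℝ≥0∞} (hx : x ≤ 1) : negExp (negLog x) = x := by
  unfold negExp negLog
  rw [EReal.coe_toENNReal]
  · simp
  · rw [EReal.le_neg]; simpa using hx

@[simp] theorem negLog_negExp (x : ℝ≥0∞) : negLog (negExp x) = x := by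
  simp [negExp, negLog]

theorem negExp_ofReal {x : ℝ} (hx : 0 ≤ x) :
    negExp (ENNReal.ofReal x) = ENNReal.ofReal (Real.exp (-x)) := by
  rw [negExp, EReal.coe_ennreal_ofReal, max_eq_left hx, ← EReal.coe_neg, EReal.exp_coe]

theorem negExp_of_ne_top {x : ℝ≥0∞} (hx : x ≠ ∞) :
    negExp x = ENNReal.ofReal (Real.exp (-x.toReal)) := by
  rw [← negExp_ofReal ENNReal.toReal_nonneg, ENNReal.ofReal_toReal hx]

theorem negExp_sum {κ : Type*} (J : Finset κ) (f : κ → ℝ≥0∞) :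
    negExp (∑ j ∈ J, f j) = ∏ j ∈ J, negExp (f j) := by
  classical
  induction J using Finset.induction_on with
  | empty => simp
  | insert a J ha ih => rw [Finset.sum_insert ha, Finset.prod_insert ha, negExp_add, ih]

theorem negExp_mul_natCast (c : ℝ≥0∞) (n : ℕ) : negExp (c * n) = negExp c ^ n := by
  induction n with
  | zero => simp
  | succ n ih => rw [Nat.cast_succ, mul_add, mul_one, negExp_add, ih, pow_succ]

theorem negLog_mul {x y : ℝ≥0∞} (hx : x ≤ 1) (hy : y ≤ 1) :
    negLog (x * y) = negLog x + negLog y := by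
  rw [← negLog_negExp (negLog x + negLog y), negExp_add, negExp_negLog hx, negExp_negLog hy]

theorem negLog_ne_top {x : ℝ≥0∞} (hx : x ≤ 1) (h0 : x ≠ 0) : negLog x ≠ ∞ := fun h => by
  rw [← negExp_negLog hx, h] at h0
  simp at h0

/-! ### The Laplace functional of a Poisson measure -/

/-- The generating function of the Poisson law at z = exp(-c), summed as an exponential series; c =
∞ is covered by z = 0. -/
theorem lintegral_negExp_pow_poissonMeasure (c : ℝ≥0∞) (r : ℝ≥0) :
    ∫⁻ n, negExp c ^ n ∂(poissonMeasure r) = negExp ((1 - negExp c) * r) := by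
  obtain ⟨z, hz⟩ : ∃ z : ℝ≥0, negExp c = z := ⟨_, (ENNReal.coe_toNNReal (negExp_ne_top c)).symm⟩
  have hz1 : z ≤ 1 := by have := negExp_le_one c; rw [hz] at this; exact_mod_cast this
  rw [hz, poissonMeasure, lintegral_sum_measure]
  have h1 : ∀ n : ℕ, ∫⁻ k, (z : ℝ≥0∞) ^ k ∂(ENNReal.ofReal (Real.exp (-r) * r ^ n / n.factorial) •
      Measure.dirac n) = ENNReal.ofReal (Real.exp (-r) * ((r * z : ℝ) ^ n / n.factorial)) := by
    intro n
    rw [lintegral_smul_measure, lintegral_dirac, smul_eq_mul, ← ENNReal.ofReal_coe_nnreal,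
      ← ENNReal.ofReal_pow z.coe_nonneg, ← ENNReal.ofReal_mul (by positivity)]
    congr 1
    rw [mul_pow]; ring
  have h2 : HasSum (fun n : ℕ => Real.exp (-r) * ((r * z : ℝ) ^ n / n.factorial))
      (Real.exp (-r) * Real.exp (r * z)) := by
    refine HasSum.mul_left _ ?_
    rw [Real.exp_eq_exp_ℝ]
    exact NormedSpace.expSeries_div_hasSum_exp (r * z : ℝ)
  simp_rw [h1]
  rw [← ENNReal.ofReal_tsum_of_nonneg (fun n => by positivity) h2.summable, h2.tsum_eq,
    ← Real.exp_add]
  have h3 : (1 - (z : ℝ≥0∞)) * r = ENNReal.ofReal ((1 - z) * r) := by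
    rw [ENNReal.ofReal_mul (by simpa using hz1), ENNReal.ofReal_sub _ z.coe_nonneg]
    simp
  rw [h3, negExp_ofReal (mul_nonneg (by simpa using hz1) r.coe_nonneg)]
  congr 2; ring

theorem tendsto_lintegral_negExp {Ω : Type*} [MeasurableSpace Ω] {P : Measure Ω}
    [IsFiniteMeasure P] {F : ℕ → Ω → ℝ≥0∞} {f : Ω → ℝ≥0∞} (hF : ∀ n, Measurable (F n))
    (h : ∀ᵐ ω ∂P, Tendsto (fun n => F n ω) atTop (𝓝 (f ω))) :
    Tendsto (fun n => ∫⁻ ω, negExp (F n ω) ∂P) atTop (𝓝 (∫⁻ ω, negExp (f ω) ∂P)) := by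
  refine tendsto_lintegral_of_dominated_convergence (fun _ => 1)
    (fun n => measurable_negExp.comp (hF n)) (fun n => ae_of_all _ fun ω => negExp_le_one _)
    (by simp) ?_
  filter_upwards [h] with ω hω using (continuous_negExp.tendsto _).comp hω

section

variable {ι Ω S : Type*} [MeasurableSpace S]

theorem lintegral_atomMeasure {a : ι → Ω → S} {g : S → ℝ≥0∞} (hg : Measurable g) (ω : Ω) :
    ∫⁻ x, g x ∂(atomMeasure a ω) = ∑' i, g (a i ω) := by
  simp [atomMeasure, lintegral_sum_measure, lintegral_dirac' _ hg]

variable [MeasurableSpace Ω]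

theorem measurable_lintegral_atomMeasure [Countable ι] {a : ι → Ω → S} (ha : ∀ i, Measurable (a i))
    {g : S → ℝ≥0∞} (hg : Measurable g) :
    Measurable fun ω => ∫⁻ x, g x ∂(atomMeasure a ω) := by
  simp_rw [lintegral_atomMeasure hg]
  exact Measurable.tsum fun i => hg.comp (ha i)

theorem measurable_atomMeasure_apply [Countable ι] {a : ι → Ω → S} (ha : ∀ i, Measurable (a i))
    {A : Set S} (hA : MeasurableSet A) : Measurable fun ω => atomMeasure a ω A := by
  simp_rw [← lintegral_indicator_one hA]
  exact measurable_lintegral_atomMeasure ha (measurable_one.indicator hA)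

variable [Countable ι] {P : Measure Ω} {η : Measure S} {a : ι → Ω → S}

theorem IsPoissonAtoms.lintegral_negExp_mul (h : IsPoissonAtoms P η a) {A : Set S}
    (hA : MeasurableSet A) (hη : η A ≠ ∞) (c : ℝ≥0∞) :
    ∫⁻ ω, negExp (c * atomMeasure a ω A) ∂P = negExp ((1 - negExp c) * η A) := by
  have hm : Measurable fun x : ℝ≥0∞ => negExp (c * x) := by fun_prop
  rw [← lintegral_map hm (measurable_atomMeasure_apply h.measurable hA), h.map_eq A hA hη,
    lintegral_map hm (by fun_prop)]
  simp_rw [negExp_mul_natCast]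
  rw [lintegral_negExp_pow_poissonMeasure, ENNReal.coe_toNNReal hη]

/-- The fibres of a simple function are disjoint, so the numbers of atoms in them are independent
and the expectation factorizes into one-set formulas. -/
theorem IsPoissonAtoms.lintegral_negExp_simpleFunc (h : IsPoissonAtoms P η a)
    (g : SimpleFunc S ℝ≥0∞) (hg : ∀ c ≠ 0, η (g ⁻¹' {c}) ≠ ∞) :
    ∫⁻ ω, negExp (∫⁻ x, g x ∂(atomMeasure a ω)) ∂P = negExp (∫⁻ x, 1 - negExp (g x) ∂η) := by
  classical
  -- The value 0 is left out: it contributes to neither side, and its fibre may have infinite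
  -- intensity.
  set R := g.range.filter (· ≠ 0) with hR
  have hsum : ∀ (f : ℝ≥0∞ → ℝ≥0∞) (μ : Measure S), f 0 = 0 →
      ∫⁻ x, f (g x) ∂μ = ∑ j : Fin R.card, f (R.equivFin.symm j : ℝ≥0∞) *
        μ (g ⁻¹' {(R.equivFin.symm j : ℝ≥0∞)}) := by
    intro f μ hf
    have h1 : ∫⁻ x, f (g x) ∂μ = ∑ c ∈ g.range, f c * μ (g ⁻¹' {c}) := by
      rw [← SimpleFunc.map_lintegral, ← SimpleFunc.lintegral_eq_lintegral]; rfl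
    rw [h1, Equiv.sum_comp R.equivFin.symm (fun c : R => f c * μ (g ⁻¹' {(c : ℝ≥0∞)})),
      Finset.sum_coe_sort R (fun c => f c * μ (g ⁻¹' {c})), hR, Finset.sum_filter_of_ne]
    rintro c - hc rfl
    simp [hf] at hc
  have h1 := h.iIndepFun R.card (fun j => g ⁻¹' {(R.equivFin.symm j : ℝ≥0∞)})
    (fun j => g.measurableSet_fiber _) (fun i j hij => by
      refine Disjoint.preimage _ (Set.disjoint_singleton.2 fun h => hij ?_)
      exact R.equivFin.symm.injective (Subtype.ext h))
  have h2 := h1.comp (fun j x => negExp ((R.equivFin.symm j : ℝ≥0∞) * x)) (fun j => by fun_prop)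
  have h3 := lintegral_prod_eq_prod_lintegral_of_indepFun Finset.univ _ h2 (fun j =>
    (show Measurable fun x : ℝ≥0∞ => negExp ((R.equivFin.symm j : ℝ≥0∞) * x) by fun_prop).comp
      (measurable_atomMeasure_apply h.measurable (g.measurableSet_fiber _)))
  simp only [Function.comp_apply] at h3
  rw [hsum (fun c => 1 - negExp c) η (by simp), negExp_sum]
  simp_rw [fun ω => hsum (fun c => c) (atomMeasure a ω) rfl, negExp_sum]
  rw [h3]
  refine Finset.prod_congr rfl fun j _ => ?_
  refine h.lintegral_negExp_mul (g.measurableSet_fiber _) (hg _ ?_) _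
  exact (Finset.mem_filter.1 (R.equivFin.symm j).2).2

/-- The Laplace functional of a Poisson measure. -/
theorem IsPoissonAtoms.lintegral_negExp [IsFiniteMeasure P] [SigmaFinite η]
    (h : IsPoissonAtoms P η a) {g : S → ℝ≥0∞} (hg : Measurable g) :
    ∫⁻ ω, negExp (∫⁻ x, g x ∂(atomMeasure a ω)) ∂P = negExp (∫⁻ x, 1 - negExp (g x) ∂η) := by
  -- Restriction to the spanning sets gives every nonzero value a fibre of finite intensity and
  -- keeps the approximation monotone.
  set G : ℕ → SimpleFunc S ℝ≥0∞ := fun n => (SimpleFunc.eapprox g n).restrict (spanningSets η n)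
    with hG
  have hGa : ∀ n x, G n x = (spanningSets η n).indicator (SimpleFunc.eapprox g n) x := fun n x => by
    rw [hG]; exact SimpleFunc.restrict_apply _ (measurableSet_spanningSets η n) x
  have hmono : ∀ x, Monotone fun n => G n x := by
    intro x m n hmn
    simp only [hGa]
    by_cases hx : x ∈ spanningSets η m
    · rw [Set.indicator_of_mem hx, Set.indicator_of_mem (monotone_spanningSets η hmn hx)]
      exact SimpleFunc.monotone_eapprox g hmn x
    · rw [Set.indicator_of_notMem hx]; exact zero_le
  have hlim : ∀ x, Tendsto (fun n => G n x) atTop (𝓝 (g x)) := by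
    intro x
    have h1 : Tendsto (fun n => SimpleFunc.eapprox g n x) atTop (𝓝 (g x)) :=
      SimpleFunc.tendsto_eapprox hg x
    refine h1.congr' ?_
    filter_upwards [eventually_ge_atTop (spanningSetsIndex η x)] with n hn
    rw [hGa, Set.indicator_of_mem]
    exact mem_spanningSets_of_index_le η x hn
  have hl : ∀ μ : Measure S, Tendsto (fun n => ∫⁻ x, G n x ∂μ) atTop (𝓝 (∫⁻ x, g x ∂μ)) :=
    fun μ => lintegral_tendsto_of_tendsto_of_monotone (fun n => (G n).measurable.aemeasurable)
      (ae_of_all _ hmono) (ae_of_all _ hlim)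
  have hr : Tendsto (fun n => ∫⁻ x, 1 - negExp (G n x) ∂η) atTop
      (𝓝 (∫⁻ x, 1 - negExp (g x) ∂η)) := by
    refine lintegral_tendsto_of_tendsto_of_monotone (fun n => ?_) (ae_of_all _ fun x m n hmn => ?_)
      (ae_of_all _ fun x => ?_)
    · exact (measurable_const.sub (measurable_negExp.comp (G n).measurable)).aemeasurable
    · exact tsub_le_tsub_left (negExp_antitone (hmono x hmn)) _
    · exact ENNReal.Tendsto.sub tendsto_const_nhds ((continuous_negExp.tendsto _).comp (hlim x))
        (Or.inl ENNReal.one_ne_top)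
  refine tendsto_nhds_unique (tendsto_lintegral_negExp
    (fun n => measurable_lintegral_atomMeasure h.measurable (G n).measurable)
    (ae_of_all _ fun ω => hl _)) ?_
  refine ((continuous_negExp.tendsto _).comp hr).congr fun n => ?_
  refine (h.lintegral_negExp_simpleFunc (G n) fun c hc => ?_).symm
  refine ne_top_of_le_ne_top (measure_spanningSets_lt_top η n).ne (measure_mono fun x hx => ?_)
  by_contra hx'
  rw [Set.mem_preimage, hGa, Set.indicator_of_notMem hx'] at hx
  exact hc hx.symm

end

/-! ### Marking -/

theorem lintegral_pi_prod {κ : Type*} [Fintype κ] {α : κ → Type*} [∀ i, MeasurableSpace (α i)]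
    (μ : ∀ i, Measure (α i)) [∀ i, IsProbabilityMeasure (μ i)] {f : ∀ i, α i → ℝ≥0∞}
    (hf : ∀ i, Measurable (f i)) :
    ∫⁻ y, ∏ i, f i (y i) ∂(Measure.pi μ) = ∏ i, ∫⁻ x, f i x ∂(μ i) := by
  refine (lintegral_prod_eq_prod_lintegral_of_indepFun Finset.univ
    (fun i (y : ∀ i, α i) => f i (y i))
    (iIndepFun_pi fun i => (hf i).aemeasurable)
    (fun i => (hf i).comp (measurable_pi_apply i))).trans ?_
  exact Finset.prod_congr rfl fun i _ => (measurePreserving_eval μ i).lintegral_comp (hf i)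

section

variable {ι Ω S W : Type*} [MeasurableSpace Ω] [MeasurableSpace S] [MeasurableSpace W]

/-- The product, over a finite set of indices, of the laws `κ (x i)`. -/
def piKernel (κ : Kernel S W) [IsMarkovKernel κ] (J : Finset ι) : Kernel (ι → S) (J → W) where
  toFun x := Measure.pi fun i : J => κ (x i)
  measurable' := by
    refine Measurable.measure_of_isPiSystem_of_isProbabilityMeasure
      generateFrom_pi.symm isPiSystem_pi ?_
    rintro _ ⟨A, hA, rfl⟩
    simp_rw [Measure.pi_pi]
    exact Finset.measurable_fun_prod _ fun i _ =>
      (κ.measurable_coe (hA i (Set.mem_univ i))).comp (measurable_pi_apply _)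

instance (κ : Kernel S W) [IsMarkovKernel κ] (J : Finset ι) : IsMarkovKernel (piKernel κ J) :=
  ⟨fun x => by change IsProbabilityMeasure (Measure.pi fun i : J => κ (x i)); infer_instance⟩

variable {P : Measure Ω} [IsProbabilityMeasure P] {a : ι → Ω → S} {ξ : ι → Ω → W}
  {κ : Kernel S W} [IsMarkovKernel κ]

/-- The hypothesis says that both measures agree on products of a measurable set of positions with a
box of marks, and these form a generating π-system. -/
theorem map_prodMk_eq_compProd_piKernel (ha : ∀ i, Measurable (a i)) (hξ : ∀ i, Measurable (ξ i))
    (h : ∀ (B : Set (ι → S)) (J : Finset ι) (A : ι → Set W), MeasurableSet B →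
      (∀ i, MeasurableSet (A i)) →
      P ({ω | (fun i => a i ω) ∈ B} ∩ {ω | ∀ i ∈ J, ξ i ω ∈ A i}) =
        ∫⁻ ω in {ω | (fun i => a i ω) ∈ B}, ∏ i ∈ J, κ (a i ω) (A i) ∂P) (J : Finset ι) :
    P.map (fun ω => ((fun i => a i ω), fun i : J => ξ i ω)) =
      (P.map fun ω i => a i ω).compProd (piKernel κ J) := by
  classical
  have ha' : Measurable fun ω i => a i ω := measurable_pi_lambda _ ha
  have hm : Measurable fun ω => ((fun i => a i ω), fun i : J => ξ i ω) :=
    ha'.prodMk (measurable_pi_lambda _ fun i => hξ i)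
  have : IsProbabilityMeasure (P.map fun ω i => a i ω) :=
    Measure.isProbabilityMeasure_map ha'.aemeasurable
  have : IsProbabilityMeasure (P.map fun ω => ((fun i => a i ω), fun i : J => ξ i ω)) :=
    Measure.isProbabilityMeasure_map hm.aemeasurable
  refine ext_of_generate_finite _ (generateFrom_eq_prod
    (MeasurableSpace.generateFrom_measurableSet (α := ι → S))
    (generateFrom_pi (α := fun _ : J => W)) isCountablySpanning_measurableSet
    (IsCountablySpanning.pi fun _ => isCountablySpanning_measurableSet)).symm
    (MeasurableSpace.isPiSystem_measurableSet.prod isPiSystem_pi) ?_ (by simp)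
  rintro _ ⟨B, hB, _, ⟨A, hA, rfl⟩, rfl⟩
  replace hB : MeasurableSet B := hB
  beta_reduce
  have hA' : ∀ i, MeasurableSet (A i) := fun i => hA i (Set.mem_univ i)
  have hpi : MeasurableSet (Set.univ.pi A) := MeasurableSet.univ_pi hA'
  -- The hypothesis takes a family of sets indexed by all of ι, so the box over `J` is extended by
  -- the whole space.
  set A' : ι → Set W := fun i => if hi : i ∈ J then A ⟨i, hi⟩ else Set.univ with hAdef
  have hA'' : ∀ i : J, A' i = A i := fun i => by simp [hAdef]
  have hA'm : ∀ i, MeasurableSet (A' i) := fun i => by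
    by_cases hi : i ∈ J
    · simpa [hAdef, hi] using hA' ⟨i, hi⟩
    · simp [hAdef, hi]
  rw [Measure.map_apply hm (hB.prod hpi), Measure.compProd_apply_prod hB hpi,
    setLIntegral_map hB ((piKernel κ J).measurable_coe hpi) ha']
  convert! h B J A' hB hA'm using 2
  · ext ω
    simp only [Set.mem_preimage, Set.mem_prod, Set.mem_pi, Set.mem_univ, true_imp_iff,
      Set.mem_inter_iff, Set.mem_ofPred_eq]
    refine and_congr_right fun _ => ⟨fun H i hi => ?_, fun H i => ?_⟩
    · rw [hA'' ⟨i, hi⟩]; exact H ⟨i, hi⟩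
    · rw [← hA'']; exact H i i.2
  · ext ω
    rw [← Finset.prod_coe_sort J]
    simp_rw [hA'']
    exact Measure.pi_pi _ _

/-- Given the positions, the marks in `J` are independent, so each can be integrated out separately.
-/
theorem lintegral_prod_marks (ha : ∀ i, Measurable (a i)) (hξ : ∀ i, Measurable (ξ i))
    (h : ∀ (B : Set (ι → S)) (J : Finset ι) (A : ι → Set W), MeasurableSet B →
      (∀ i, MeasurableSet (A i)) →
      P ({ω | (fun i => a i ω) ∈ B} ∩ {ω | ∀ i ∈ J, ξ i ω ∈ A i}) =
        ∫⁻ ω in {ω | (fun i => a i ω) ∈ B}, ∏ i ∈ J, κ (a i ω) (A i) ∂P) (J : Finset ι)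
    {f : S × W → ℝ≥0∞} (hf : Measurable f) :
    ∫⁻ ω, ∏ i ∈ J, f (a i ω, ξ i ω) ∂P =
      ∫⁻ ω, ∏ i ∈ J, ∫⁻ w, f (a i ω, w) ∂(κ (a i ω)) ∂P := by
  have ha' : Measurable fun ω i => a i ω := measurable_pi_lambda _ ha
  have hm : Measurable fun ω => ((fun i => a i ω), fun i : J => ξ i ω) :=
    ha'.prodMk (measurable_pi_lambda _ fun i => hξ i)
  have hG : Measurable fun p : (ι → S) × (J → W) => ∏ i : J, f (p.1 i, p.2 i) := by fun_prop
  have h1 := lintegral_map (μ := P) hG hm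
  rw [map_prodMk_eq_compProd_piKernel ha hξ h J, Measure.lintegral_compProd hG,
    lintegral_map hG.lintegral_kernel_prod_right' ha'] at h1
  simp_rw [← Finset.prod_coe_sort J]
  rw [← h1]
  refine lintegral_congr fun ω => ?_
  exact lintegral_pi_prod (fun i : J => κ (a i ω)) (f := fun i w => f (a i ω, w))
    fun i => by fun_prop

/-- The Laplace functional of a marked Poisson measure. -/
theorem IsPoissonAtoms.lintegral_negExp_marks [Countable ι] {η : Measure S} [SigmaFinite η]
    (hp : IsPoissonAtoms P η a) (hξ : ∀ i, Measurable (ξ i))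
    (h : ∀ (B : Set (ι → S)) (J : Finset ι) (A : ι → Set W), MeasurableSet B →
      (∀ i, MeasurableSet (A i)) →
      P ({ω | (fun i => a i ω) ∈ B} ∩ {ω | ∀ i ∈ J, ξ i ω ∈ A i}) =
        ∫⁻ ω in {ω | (fun i => a i ω) ∈ B}, ∏ i ∈ J, κ (a i ω) (A i) ∂P)
    {f : S × W → ℝ≥0∞} (hf : Measurable f) :
    ∫⁻ ω, negExp (∑' i, f (a i ω, ξ i ω)) ∂P =
      negExp (∫⁻ x, 1 - ∫⁻ w, negExp (f (x, w)) ∂(κ x) ∂η) := by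
  set k : S → ℝ≥0∞ := fun x => ∫⁻ w, negExp (f (x, w)) ∂(κ x) with hk
  have hkm : Measurable k := (measurable_negExp.comp hf).lintegral_kernel_prod_right'
  have hk1 : ∀ x, k x ≤ 1 := fun x => (lintegral_mono fun w => negExp_le_one _).trans (by simp)
  have ha := hp.measurable
  obtain ⟨J, hJ⟩ := exists_seq_tendsto (atTop : Filter (Finset ι))
  have hs : ∀ u : ι → ℝ≥0∞, Tendsto (fun n => ∑ i ∈ J n, u i) atTop (𝓝 (∑' i, u i)) :=
    fun u => ENNReal.summable.hasSum.comp hJ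
  have h1 : Tendsto (fun n => ∫⁻ ω, negExp (∑ i ∈ J n, f (a i ω, ξ i ω)) ∂P) atTop
      (𝓝 (∫⁻ ω, negExp (∑' i, f (a i ω, ξ i ω)) ∂P)) :=
    tendsto_lintegral_negExp (fun n => Finset.measurable_fun_sum _ fun i _ =>
      hf.comp ((ha i).prodMk (hξ i))) (ae_of_all _ fun ω => hs _)
  have h2 : Tendsto (fun n => ∫⁻ ω, negExp (∑ i ∈ J n, negLog (k (a i ω))) ∂P) atTop
      (𝓝 (∫⁻ ω, negExp (∑' i, negLog (k (a i ω))) ∂P)) :=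
    tendsto_lintegral_negExp (fun n => Finset.measurable_fun_sum _ fun i _ =>
      measurable_negLog.comp (hkm.comp (ha i))) (ae_of_all _ fun ω => hs _)
  -- Integrating out the marks turns `f` into the weight `negLog ∘ k` on the bare points, to which
  -- the unmarked formula applies. The products over finite sets of points then pass to the limit on
  -- both sides.
  have h3 := hp.lintegral_negExp (g := fun x => negLog (k x)) (measurable_negLog.comp hkm)
  simp only [lintegral_atomMeasure (g := fun x => negLog (k x)) (measurable_negLog.comp hkm),
    negExp_negLog (hk1 _)] at h3
  rw [← h3]
  refine tendsto_nhds_unique h1 (h2.congr fun n => ?_)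
  simp_rw [negExp_sum, negExp_negLog (hk1 _)]
  exact (lintegral_prod_marks ha hξ h (J n) (measurable_negExp.comp hf)).symm

end

/-! ### Measurable finitely additive set functions are countably additive -/

section

variable {ι : Type*} [Countable ι]

/-- A topological zero-one law: a Borel set of subsets of a countable set, which does not change
when a single element is added or removed, is meagre or comeagre. -/
theorem mem_residual_of_flip_invariant [DecidableEq ι] {A : Set (ι → Bool)} (hA : MeasurableSet A)
    (hflip : ∀ i S, Function.update S i (!S i) ∈ A ↔ S ∈ A) (hne : Aᶜ ∉ residual (ι → Bool)) :
    A ∈ residual (ι → Bool) := by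
  set φ : Finset ι → (ι → Bool) → ι → Bool := fun F S i => if i ∈ F then !S i else S i with hφ
  have hinv : ∀ F, Function.Involutive (φ F) := fun F S => by
    ext i; by_cases hi : i ∈ F <;> simp [hφ, hi]
  have hcont : ∀ F, Continuous (φ F) := fun F => by
    refine continuous_pi fun i => ?_
    by_cases hi : i ∈ F
    · simp only [hφ, hi, if_true]
      exact (continuous_of_discreteTopology (f := Bool.not)).comp (continuous_apply i)
    · simpa only [hφ, hi, if_false] using continuous_apply i
  have hopen : ∀ F, IsOpenMap (φ F) := fun F =>
    (Homeomorph.mk (hinv F).toPerm (hcont F) (hcont F)).isOpenMap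
  have hmem : ∀ F S, φ F S ∈ A ↔ S ∈ A := by
    intro F
    induction F using Finset.induction_on with
    | empty => intro S; simp [hφ]
    | insert a F ha ih =>
      intro S
      rw [← ih S, ← hflip a (φ F S)]
      convert! Iff.rfl using 2
      ext i
      by_cases hi : i = a
      · subst hi; simp [hφ, ha]
      · simp [hφ, hi]
  -- Baire property: a Borel set differs from some open set by a meagre set. That open set is
  -- nonempty because `A` is not meagre.
  obtain ⟨U, hU, hAU⟩ := MeasurableSet.residualEq_isOpen hA
  obtain ⟨x, hx⟩ : U.Nonempty := by
    by_contra h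
    rw [Set.not_nonempty_iff_eq_empty] at h
    subst h
    refine hne ?_
    filter_upwards [hAU.mem_iff] with S hS
    simpa using hS
  obtain ⟨J, u, hu, hJ⟩ := isOpen_pi_iff.1 hU x hx
  -- There are countably many finite flips and each is a homeomorphism, so generically all flips of
  -- `S` lie in `A` exactly when they lie in `U`.
  have key : ∀ᶠ S in residual (ι → Bool), ∀ F, φ F S ∈ A ↔ φ F S ∈ U :=
    eventually_countable_forall.2 fun F =>
      (tendsto_residual_of_isOpenMap (hcont F) (hopen F)).eventually hAU.mem_iff
  filter_upwards [key] with S hS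
  -- Flipping the coordinates in `J` where `S` differs from `x` moves `S` into the cylinder inside
  -- `U`, hence into `A`; invariance brings it back.
  rw [← hmem (J.filter fun i => S i ≠ x i), hS]
  refine hJ fun i hi => ?_
  have : φ (J.filter fun i => S i ≠ x i) S i = x i := by
    have hi' : i ∈ J := hi
    simp only [hφ, Finset.mem_filter, hi', true_and]
    cases S i <;> cases x i <;> simp
  rw [this]
  exact (hu i hi).2

/-- Let g be the total mass. The sets of mass at least g/2 form a flip-invariant Borel family, which
is not meagre because it contains each set or its complement. By the zero-one law it is comeagre.
The three classes of a generic 3-colouring then all have mass at least g/2, so 3g ≤ 2g, and g = 0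
since g is finite. -/
theorem eq_zero_of_additive_of_flip_invariant [DecidableEq ι] {G : (ι → Bool) → ℝ≥0∞}
    (hG : Measurable G) (hfin : G (fun _ => true) ≠ ∞)
    (hadd : ∀ S T : ι → Bool, (∀ i, (S i && T i) = false) → G (fun i => S i || T i) = G S + G T)
    (hflip : ∀ i S, G (Function.update S i (!S i)) = G S) : G (fun _ => true) = 0 := by
  set A : Set (ι → Bool) := {S | G (fun _ => true) ≤ 2 * G S} with hAdef
  have hA : MeasurableSet A := measurableSet_le measurable_const (hG.const_mul 2)
  have hcompl : ∀ S : ι → Bool, G (fun _ => true) = G S + G (fun i => !S i) := fun S => by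
    rw [← hadd S _ (by simp)]
    simp
  have hres : A ∈ residual (ι → Bool) := by
    refine mem_residual_of_flip_invariant hA (fun i S => by simp [hAdef, hflip]) fun h => ?_
    have hnot : Continuous fun (S : ι → Bool) i => !S i := continuous_pi fun i =>
      (continuous_of_discreteTopology (f := Bool.not)).comp (continuous_apply i)
    have hinv : Function.Involutive fun (S : ι → Bool) i => !S i := fun S => by ext i; simp
    have h' := (tendsto_residual_of_isOpenMap hnot
      (Homeomorph.mk hinv.toPerm hnot hnot).isOpenMap) h
    obtain ⟨S, hS, hS'⟩ := (dense_of_mem_residual (inter_mem h h')).nonempty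
    simp only [hAdef, Set.mem_compl_iff, Set.mem_preimage, Set.mem_ofPred_eq, not_le] at hS hS'
    refine lt_irrefl (2 * G fun _ => true) ?_
    calc 2 * (G fun _ => true) = 2 * G S + 2 * G (fun i => !S i) := by rw [hcompl S, mul_add]
      _ < (G fun _ => true) + (G fun _ => true) := ENNReal.add_lt_add hS hS'
      _ = _ := (two_mul _).symm
  -- The map from a colouring to one of its colour classes is continuous and open, so comeagre sets
  -- pull back to comeagre sets.
  have hcol : ∀ j : Fin 3, (fun (c : ι → Fin 3) i => decide (c i = j)) ⁻¹' A ∈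
      residual (ι → Fin 3) := by
    intro j
    refine tendsto_residual_of_isOpenMap (continuous_pi fun i =>
      (continuous_of_discreteTopology (f := fun k : Fin 3 => decide (k = j))).comp
        (continuous_apply i)) ?_ hres
    refine IsOpenMap.piMap (f := fun _ (k : Fin 3) => decide (k = j))
      (fun i s _ => isOpen_discrete _) (Eventually.of_forall fun i b => ?_)
    cases b
    · exact ⟨j + 1, by revert j; decide⟩
    · exact ⟨j, by simp⟩
  obtain ⟨c, ⟨h0, h1⟩, h2⟩ := (dense_of_mem_residual
    (inter_mem (inter_mem (hcol 0) (hcol 1)) (hcol 2))).nonempty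
  simp only [hAdef, Set.mem_preimage, Set.mem_ofPred_eq] at h0 h1 h2
  have hsum : (G fun _ => true) = G (fun i => decide (c i = 0)) + G (fun i => decide (c i = 1)) +
      G (fun i => decide (c i = 2)) := by
    have hd : ∀ a b : Fin 3, a ≠ b → ∀ i, (decide (c i = a) && decide (c i = b)) = false := by
      intro a b hab i
      by_cases h : c i = a <;> simp [h, hab]
    rw [← hadd _ _ (hd 0 1 (by decide)), ← hadd]
    · congr 1; ext i; generalize c i = k; revert k; decide
    · intro i; generalize c i = k; revert k; decide
  set g := G fun _ => true
  have h3 : g + (g + g) ≤ 0 + (g + g) := by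
    calc g + (g + g) ≤ 2 * G (fun i => decide (c i = 0)) + (2 * G (fun i => decide (c i = 1)) +
          2 * G (fun i => decide (c i = 2))) := by gcongr
      _ = 2 * g := by rw [hsum]; ring
      _ = 0 + (g + g) := by rw [zero_add, two_mul]
  simpa using (ENNReal.add_le_add_iff_right (by simpa using hfin)).1 h3

/-- Subtracting the sum `c` of the point masses from `m` leaves an additive Borel function that
ignores single elements, hence vanishes. Measurability is essential: the indicator of a nonprincipal
ultrafilter is finitely additive and vanishes on singletons. -/
theorem eq_tsum_of_additive_of_measurable [DecidableEq ι] {m : (ι → Bool) → ℝ≥0∞}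
    (hm : Measurable m) (hfin : m (fun _ => true) ≠ ∞)
    (hadd : ∀ S T : ι → Bool, (∀ i, (S i && T i) = false) → m (fun i => S i || T i) = m S + m T) :
    m (fun _ => true) = ∑' i, m (fun j => decide (j = i)) := by
  set c : (ι → Bool) → ℝ≥0∞ := fun S => ∑' i, if S i then m (fun j => decide (j = i)) else 0
    with hc
  have hmono : ∀ S T : ι → Bool, (∀ i, S i = true → T i = true) → m S ≤ m T := by
    intro S T hST
    have h := hadd S (fun i => T i && !S i) (fun i => by cases S i <;> simp)
    have h' : (fun i => S i || T i && !S i) = T := by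
      ext i
      have := hST i
      cases hS : S i <;> cases hT : T i <;> simp_all
    rw [h'] at h
    rw [h]; exact le_self_add
  have hfin' : ∀ S, m S ≠ ∞ := fun S => ne_top_of_le_ne_top hfin (hmono _ _ (by simp))
  have hempty : m (fun _ => false) = 0 := by
    have := hadd (fun _ => false) (fun _ => false) (by simp)
    simp only [Bool.or_self] at this
    have h2 : m (fun _ => false) + 0 = m (fun _ => false) + m (fun _ => false) := by
      rw [add_zero]; exact this
    exact ((ENNReal.add_right_inj (hfin' _)).1 h2).symm
  have hfinset : ∀ (S : ι → Bool) (F : Finset ι),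
      (∑ i ∈ F, if S i then m (fun j => decide (j = i)) else 0) =
        m (fun j => S j && decide (j ∈ F)) := by
    intro S F
    induction F using Finset.induction_on with
    | empty => simpa using hempty.symm
    | insert a F ha ih =>
      rw [Finset.sum_insert ha, ih]
      by_cases hS : S a = true
      · rw [if_pos hS, ← hadd]
        · congr 1
          ext j
          by_cases hj : j = a
          · subst hj; simp [hS]
          · simp [hj]
        · intro i
          by_cases hi : i = a
          · subst hi; simp [ha]
          · simp [hi]
      · rw [if_neg hS, zero_add]
        congr 1
        ext j
        by_cases hj : j = a
        · subst hj; simp [hS]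
        · simp [hj]
  have hcm : ∀ S, c S ≤ m S := fun S => by
    simp only [hc]
    rw [ENNReal.tsum_eq_iSup_sum]
    refine iSup_le fun F => ?_
    rw [hfinset]
    exact hmono _ _ (by simp +contextual)
  have hcfin : ∀ S, c S ≠ ∞ := fun S => ne_top_of_le_ne_top (hfin' S) (hcm S)
  have hcadd : ∀ S T : ι → Bool, (∀ i, (S i && T i) = false) →
      c (fun i => S i || T i) = c S + c T := by
    intro S T h
    rw [hc, ← ENNReal.tsum_add]
    refine tsum_congr fun i => ?_
    have := h i
    cases hS : S i <;> cases hT : T i <;> simp_all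
  have hcsingle : ∀ i, c (fun j => decide (j = i)) = m (fun j => decide (j = i)) := by
    intro i
    simp only [hc]
    rw [tsum_eq_single i (fun j hj => by simp [hj])]
    simp
  have hcmeas : Measurable c := by
    refine Measurable.tsum fun i => Measurable.ite ?_ measurable_const measurable_const
    exact measurable_pi_apply (X := fun _ : ι => Bool) i (measurableSet_singleton true)
  have hGadd : ∀ S T : ι → Bool, (∀ i, (S i && T i) = false) →
      m (fun i => S i || T i) - c (fun i => S i || T i) = (m S - c S) + (m T - c T) := by
    intro S T h
    rw [hadd S T h, hcadd S T h]
    refine ENNReal.sub_eq_of_eq_add (ENNReal.add_ne_top.2 ⟨hcfin S, hcfin T⟩) ?_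
    calc m S + m T = (m S - c S + c S) + (m T - c T + c T) := by
          rw [tsub_add_cancel_of_le (hcm S), tsub_add_cancel_of_le (hcm T)]
      _ = _ := by ring
  have hupd : ∀ i (S : ι → Bool), S i = false →
      m (Function.update S i true) - c (Function.update S i true) = m S - c S := by
    intro i S hS
    have h := hGadd S (fun j => decide (j = i)) (fun j => by
      by_cases hj : j = i
      · subst hj; simp [hS]
      · simp [hj])
    rw [hcsingle, tsub_self, add_zero] at h
    rw [← h]
    have h' : Function.update S i true = fun j => S j || decide (j = i) := by
      ext j
      by_cases hj : j = i
      · subst hj; simp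
      · simp [hj]
    rw [h']
  have h0 := eq_zero_of_additive_of_flip_invariant (G := fun S => m S - c S) (hm.sub hcmeas)
    (ne_top_of_le_ne_top hfin tsub_le_self) hGadd (fun i S => by
      cases hS : S i
      · exact hupd i S hS
      · have h := hupd i (Function.update S i false) (by simp)
        rw [Function.update_idem, ← hS, Function.update_eq_self] at h
        exact h.symm)
  refine le_antisymm ((tsub_eq_zero_iff_le.1 h0).trans (le_of_eq ?_)) ?_
  · simp [hc]
  · simpa [hc] using hcm fun _ => true

end

/-! ### The vague topology -/

instance : LocallyCompactSpace PosReal := isOpen_Ioi.locallyCompactSpace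

instance : Nonempty PosReal := ⟨⟨1, by simp⟩⟩

instance (u : RadonPointMeasure) : IsFiniteMeasureOnCompacts u.toMeasure :=
  ⟨fun K hK => u.isRadonPoint.2 K hK⟩

namespace RadonPointMeasure

@[ext]
theorem ext {u v : RadonPointMeasure} (h : u.toMeasure = v.toMeasure) : u = v := by
  cases u; cases v; cases h; rfl

@[simp] theorem toMeasure_add (u v : RadonPointMeasure) :
    (u + v).toMeasure = u.toMeasure + v.toMeasure := rfl

@[simp] theorem toMeasure_zero : (0 : RadonPointMeasure).toMeasure = 0 := rfl

theorem toMeasure_ofMeasure {m : Measure PosReal} (h : IsRadonPoint m) :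
    (ofMeasure m).toMeasure = m := by
  rw [ofMeasure, dif_pos h]

/-- The integral of a nonnegative function, as a nonnegative real. It is only of interest for
functions with a finite integral. -/
def pair (φ : PosReal → ℝ≥0) (u : RadonPointMeasure) : ℝ≥0 := (∫⁻ x, φ x ∂u.toMeasure).toNNReal

section

variable {φ : PosReal → ℝ≥0} (hφ : Continuous φ) (hc : HasCompactSupport φ)

include hφ hc

theorem integrable_testFunction (u : RadonPointMeasure) :
    Integrable (fun x => (φ x : ℝ)) u.toMeasure :=
  (NNReal.continuous_coe.comp hφ).integrable_of_hasCompactSupport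
    (hc.comp_left (g := ((↑) : ℝ≥0 → ℝ)) NNReal.coe_zero)

theorem lintegral_testFunction_ne_top (u : RadonPointMeasure) :
    ∫⁻ x, φ x ∂u.toMeasure ≠ ∞ := by
  have h := (integrable_testFunction hφ hc u).lintegral_lt_top
  simpa using h.ne

theorem coe_pair (u : RadonPointMeasure) : (pair φ u : ℝ≥0∞) = ∫⁻ x, φ x ∂u.toMeasure :=
  ENNReal.coe_toNNReal (lintegral_testFunction_ne_top hφ hc u)

theorem coe_pair_real (u : RadonPointMeasure) : (pair φ u : ℝ) = ∫ x, (φ x : ℝ) ∂u.toMeasure := by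
  rw [integral_eq_lintegral_of_nonneg_ae (ae_of_all _ fun x => (φ x).coe_nonneg)
    (integrable_testFunction hφ hc u).1, pair]
  simp [ENNReal.toReal]

theorem continuous_pair : Continuous (pair φ) := by
  refine NNReal.isEmbedding_coe.continuous_iff.2 ?_
  have h : Continuous fun (u : RadonPointMeasure)
      (ψ : CompactlySupportedContinuousMap PosReal ℝ) => ∫ x, ψ x ∂u.toMeasure :=
    continuous_induced_dom
  have h2 := (continuous_apply (⟨⟨fun x => (φ x : ℝ), NNReal.continuous_coe.comp hφ⟩,
    hc.comp_left (g := ((↑) : ℝ≥0 → ℝ)) NNReal.coe_zero⟩ : CompactlySupportedContinuousMap PosReal ℝ)).comp h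
  refine h2.congr fun u => ?_
  exact (coe_pair_real hφ hc u).symm

end

/-- A real test function is the difference of its positive and negative parts, which are again test
functions. -/
theorem continuous_iff_forall_pair {Y : Type*} [TopologicalSpace Y] {f : Y → RadonPointMeasure} :
    Continuous f ↔ ∀ φ : PosReal → ℝ≥0, Continuous φ → HasCompactSupport φ →
      Continuous fun y => pair φ (f y) := by
  refine ⟨fun h φ hφ hc => (continuous_pair hφ hc).comp h, fun h => ?_⟩
  refine continuous_induced_rng.2 (continuous_pi fun ψ => ?_)
  have hcont : Continuous ψ := ψ.continuous
  have hp : Continuous fun x => (ψ x).toNNReal := continuous_real_toNNReal.comp hcont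
  have hn : Continuous fun x => (-ψ x).toNNReal := continuous_real_toNNReal.comp hcont.neg
  have hpc : HasCompactSupport fun x => (ψ x).toNNReal :=
    ψ.hasCompactSupport.comp_left (g := Real.toNNReal) (by simp)
  have hnc : HasCompactSupport fun x => (-ψ x).toNNReal :=
    ψ.hasCompactSupport.comp_left (g := fun y => Real.toNNReal (-y)) (by simp)
  refine ((NNReal.continuous_coe.comp (h _ hp hpc)).sub
    (NNReal.continuous_coe.comp (h _ hn hnc))).congr fun y => ?_
  simp only [Pi.sub_apply, Function.comp_apply]
  rw [coe_pair_real hp hpc, coe_pair_real hn hnc,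
    ← integral_sub (integrable_testFunction hp hpc _) (integrable_testFunction hn hnc _)]
  refine integral_congr_ae (ae_of_all _ fun x => ?_)
  simp only [Real.coe_toNNReal']
  rcases le_total 0 (ψ x) with hx | hx
  · rw [max_eq_left hx, max_eq_right (by linarith)]; ring
  · rw [max_eq_right hx, max_eq_left (by linarith)]; ring

/-! ### A countable family of test functions that induces the vague topology -/

theorem exists_cutoff (n : ℕ) : ∃ χ : PosReal → ℝ≥0, Continuous χ ∧ HasCompactSupport χ ∧
    ∀ x ∈ CompactExhaustion.choice PosReal n, χ x = 1 := by
  obtain ⟨f, hf1, -, hfc, -⟩ := exists_continuous_one_zero_of_isCompact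
    ((CompactExhaustion.choice PosReal).isCompact n) isClosed_empty (Set.disjoint_empty _)
  refine ⟨fun x => (f x).toNNReal, continuous_real_toNNReal.comp f.continuous,
    hfc.comp_left (g := Real.toNNReal) (by simp), fun x hx => ?_⟩
  simp [hf1 hx]

/-- Continuous functions with compact support that are equal to one on larger and larger compact
sets. -/
def cutoff (n : ℕ) : PosReal → ℝ≥0 := (exists_cutoff n).choose

theorem continuous_cutoff (n : ℕ) : Continuous (cutoff n) := (exists_cutoff n).choose_spec.1

theorem hasCompactSupport_cutoff (n : ℕ) : HasCompactSupport (cutoff n) :=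
  (exists_cutoff n).choose_spec.2.1

theorem cutoff_eq_one {n : ℕ} {x : PosReal} (hx : x ∈ CompactExhaustion.choice PosReal n) :
    cutoff n x = 1 :=
  (exists_cutoff n).choose_spec.2.2 x hx

/-- A countable family of test functions that determines the vague topology. -/
def testFun : Option ℕ × ℕ → PosReal → ℝ≥0
  | (none, n) => cutoff n
  | (some k, n) => fun x => (TopologicalSpace.denseSeq C(PosReal, ℝ) k x).toNNReal * cutoff n x

theorem continuous_testFun : ∀ j, Continuous (testFun j)
  | (none, n) => continuous_cutoff n
  | (some k, n) => (continuous_real_toNNReal.comp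
      (TopologicalSpace.denseSeq C(PosReal, ℝ) k).continuous).mul (continuous_cutoff n)

theorem hasCompactSupport_testFun : ∀ j, HasCompactSupport (testFun j)
  | (none, n) => hasCompactSupport_cutoff n
  | (some _, n) => (hasCompactSupport_cutoff n).mul_left

/-- Take a cutoff equal to one on the support of φ, and approximate φ uniformly on the support of
that cutoff by a member of a dense sequence. The error is bounded by a multiple of the cutoff, so
its integral is controlled for every Radon measure. -/
theorem exists_testFun_approx {φ : PosReal → ℝ≥0} (hφ : Continuous φ) (hc : HasCompactSupport φ) :
    ∃ n, ∀ ε > 0, ∃ k, ∀ x, |(φ x : ℝ) - testFun (some k, n) x| ≤ ε * cutoff n x := by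
  obtain ⟨n, hn⟩ := (CompactExhaustion.choice PosReal).exists_superset_of_isCompact hc
  refine ⟨n, fun ε hε => ?_⟩
  set f : C(PosReal, ℝ) := ⟨fun x => (φ x : ℝ), NNReal.continuous_coe.comp hφ⟩
  have hnhds : {g : C(PosReal, ℝ) | ∀ x ∈ tsupport (cutoff n), dist (f x) (g x) < ε} ∈ 𝓝 f := by
    have h := ContinuousMap.tendsto_iff_forall_isCompact_tendstoUniformlyOn.1
      (tendsto_id (x := 𝓝 f)) (tsupport (cutoff n)) (hasCompactSupport_cutoff n)
    exact Metric.tendstoUniformlyOn_iff.1 h ε hε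
  obtain ⟨_, ⟨k, rfl⟩, hk⟩ := (TopologicalSpace.denseRange_denseSeq C(PosReal, ℝ)).inter_nhds_nonempty
    hnhds
  refine ⟨k, fun x => ?_⟩
  set g := TopologicalSpace.denseSeq C(PosReal, ℝ) k
  have h1 : (φ x : ℝ) = φ x * cutoff n x := by
    by_cases hx : x ∈ tsupport φ
    · rw [cutoff_eq_one (hn hx)]; simp
    · rw [image_eq_zero_of_notMem_tsupport hx]; simp
  have h2 : (testFun (some k, n) x : ℝ) = max (g x) 0 * cutoff n x := by
    simp [testFun, g]
  rw [h1, h2, ← sub_mul, abs_mul, abs_of_nonneg (cutoff n x).coe_nonneg]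
  by_cases hx : x ∈ tsupport (cutoff n)
  · refine mul_le_mul_of_nonneg_right ?_ (cutoff n x).coe_nonneg
    have h3 : |(φ x : ℝ) - g x| < ε := hk x hx
    have h4 : (φ x : ℝ) = max (φ x : ℝ) 0 := (max_eq_left (φ x).coe_nonneg).symm
    rw [h4]
    exact (abs_max_sub_max_le_abs _ _ _).trans h3.le
  · simp [image_eq_zero_of_notMem_tsupport hx]

/-- The error in the integrals is ε times the integral of the cutoff, which need not be bounded in
`y`. Division by one plus that integral makes the approximation uniform, and the divisor is itself
continuous. -/
theorem continuous_iff_forall_testFun {Y : Type*} [TopologicalSpace Y]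
    {f : Y → RadonPointMeasure} :
    Continuous f ↔ ∀ j, Continuous fun y => pair (testFun j) (f y) := by
  refine ⟨fun h j => (continuous_pair (continuous_testFun j) (hasCompactSupport_testFun j)).comp h,
    fun h => continuous_iff_forall_pair.2 fun φ hφ hc => ?_⟩
  obtain ⟨n, hn⟩ := exists_testFun_approx hφ hc
  have hden : ∀ y, (0 : ℝ) < 1 + pair (cutoff n) (f y) := fun y => by positivity
  have hcn : Continuous fun y => (1 + pair (cutoff n) (f y) : ℝ) :=
    continuous_const.add (NNReal.continuous_coe.comp (h (none, n)))
  have key : Continuous fun y => (pair φ (f y) : ℝ) / (1 + pair (cutoff n) (f y)) := by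
    refine continuous_of_uniform_approx_of_continuous fun U hU => ?_
    obtain ⟨ε, hε, hεU⟩ := Metric.mem_uniformity_dist.1 hU
    obtain ⟨k, hk⟩ := hn (ε / 2) (by positivity)
    refine ⟨fun y => (pair (testFun (some k, n)) (f y) : ℝ) / (1 + pair (cutoff n) (f y)),
      (NNReal.continuous_coe.comp (h (some k, n))).div hcn fun y => (hden y).ne', fun y => hεU ?_⟩
    have hb : |(pair φ (f y) : ℝ) - pair (testFun (some k, n)) (f y)| ≤
        ε / 2 * pair (cutoff n) (f y) := by
      rw [coe_pair_real hφ hc,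
        coe_pair_real (continuous_testFun (some k, n)) (hasCompactSupport_testFun (some k, n)),
        coe_pair_real (continuous_cutoff n) (hasCompactSupport_cutoff n), ← integral_sub
          (integrable_testFunction hφ hc _) (integrable_testFunction (continuous_testFun (some k, n))
            (hasCompactSupport_testFun (some k, n)) _), ← integral_const_mul]
      refine abs_integral_le_integral_abs.trans (integral_mono_of_nonneg
        (ae_of_all _ fun x => abs_nonneg _) ((integrable_testFunction (continuous_cutoff n)
          (hasCompactSupport_cutoff n) _).const_mul _) (ae_of_all _ hk))
    rw [Real.dist_eq, ← sub_div, abs_div, abs_of_pos (hden y), div_lt_iff₀ (hden y)]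
    have : (0 : ℝ) ≤ pair (cutoff n) (f y) := NNReal.coe_nonneg _
    nlinarith
  refine NNReal.isEmbedding_coe.continuous_iff.2 ?_
  refine (key.mul hcn).congr fun y => ?_
  exact div_mul_cancel₀ _ (hden y).ne'

/-- The integrals of the test functions. -/
def coords (u : RadonPointMeasure) (j : Option ℕ × ℕ) : ℝ≥0 := pair (testFun j) u

/-- Countably many real coordinates induce the vague topology, which makes it second countable and
pseudometrizable. -/
theorem isInducing_coords : IsInducing coords := by
  refine ⟨le_antisymm (continuous_iff_le_induced.1 (continuous_pi fun j =>
    continuous_pair (continuous_testFun j) (hasCompactSupport_testFun j))) ?_⟩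
  rw [← continuous_id_iff_le]
  let : TopologicalSpace RadonPointMeasure := TopologicalSpace.induced coords inferInstance
  exact continuous_iff_forall_testFun.2 fun j => 
    (continuous_apply j).comp (continuous_induced_dom (f := coords))

instance : SecondCountableTopology RadonPointMeasure := isInducing_coords.secondCountableTopology

instance : TopologicalSpace.PseudoMetrizableSpace RadonPointMeasure :=
  isInducing_coords.pseudoMetrizableSpace

end RadonPointMeasure

namespace RadonPointMeasure

/-! ### Measurability in the space of Radon point measures -/

theorem borel_eq_comap_coords :
    borel RadonPointMeasure = MeasurableSpace.comap coords inferInstance := by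
  have h : borel RadonPointMeasure =
      @borel RadonPointMeasure (TopologicalSpace.induced coords inferInstance) :=
    congrArg (fun t => @borel RadonPointMeasure t) isInducing_coords.eq_induced
  refine h.trans (borel_comap.trans ?_)
  rw [← BorelSpace.measurable_eq]

theorem measurable_coords : Measurable coords := isInducing_coords.continuous.measurable

theorem measurable_iff_coords {Ω : Type*} [MeasurableSpace Ω] {f : Ω → RadonPointMeasure} :
    Measurable f ↔ Measurable fun ω => coords (f ω) := by
  refine ⟨fun h => measurable_coords.comp h, fun h => ?_⟩
  change @Measurable Ω RadonPointMeasure _ (borel RadonPointMeasure) f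
  rw [borel_eq_comap_coords]
  exact measurable_comap_iff.2 h

theorem aemeasurable_iff_coords {Ω : Type*} [MeasurableSpace Ω] {μ : Measure Ω}
    {f : Ω → RadonPointMeasure} :
    AEMeasurable f μ ↔ ∀ j, AEMeasurable (fun ω => coords (f ω) j) μ := by
  classical
  refine ⟨fun h j => ((measurable_pi_apply j).comp measurable_coords).comp_aemeasurable h,
    fun h => ?_⟩
  have hg : AEMeasurable (fun ω => coords (f ω)) μ := aemeasurable_pi_iff.2 h
  -- A measurable version of the coordinates need not take values in the range of `coords`. Instead
  -- `f` itself is set to zero on a measurable null set off which it agrees with that version.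
  set t := toMeasurable μ {ω | ¬ coords (f ω) = hg.mk _ ω} with ht
  have ht0 : μ t = 0 := (measure_toMeasurable _).trans (ae_iff.1 hg.ae_eq_mk)
  have htm : MeasurableSet t := measurableSet_toMeasurable _ _
  refine ⟨t.piecewise (fun _ => 0) f, measurable_iff_coords.2 ?_, ?_⟩
  · have : (fun ω => coords (t.piecewise (fun _ => 0) f ω)) =
        t.piecewise (fun _ => coords 0) (hg.mk _) := by
      ext1 ω
      by_cases hω : ω ∈ t
      · simp [hω]
      · have h1 : coords (f ω) = hg.mk _ ω := by
          by_contra h1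
          exact hω (subset_toMeasurable _ _ h1)
        simp [hω, h1]
    rw [this]
    exact measurable_const.piecewise htm hg.measurable_mk
  · filter_upwards [measure_eq_zero_iff_ae_notMem.1 ht0] with ω hω
    simp [hω]

/-- The cutoff makes the measures finite, so it suffices to treat closed sets, whose indicators are
limits of bounded continuous functions; times the cutoff, these are test functions. -/
theorem measurable_withDensity_cutoff (n : ℕ) : Measurable fun u : RadonPointMeasure =>
    u.toMeasure.withDensity fun x => (cutoff n x : ℝ≥0∞) := by
  have hcm : Measurable fun x => (cutoff n x : ℝ≥0∞) :=
    (continuous_cutoff n).measurable.coe_nnreal_ennreal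
  have hfin : ∀ u : RadonPointMeasure, IsFiniteMeasure
      (u.toMeasure.withDensity fun x => (cutoff n x : ℝ≥0∞)) := fun u =>
    isFiniteMeasure_withDensity
      (lintegral_testFunction_ne_top (continuous_cutoff n) (hasCompactSupport_cutoff n) u)
  have hint : ∀ f : BoundedContinuousFunction PosReal ℝ≥0, Measurable fun u : RadonPointMeasure =>
      ∫⁻ x, f x ∂(u.toMeasure.withDensity fun x => (cutoff n x : ℝ≥0∞)) := by
    intro f
    have hc : Continuous fun x => cutoff n x * f x := (continuous_cutoff n).mul f.continuous
    have hs : HasCompactSupport fun x => cutoff n x * f x := (hasCompactSupport_cutoff n).mul_right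
    convert (continuous_pair hc hs).measurable.coe_nnreal_ennreal using 1
    ext1 u
    rw [coe_pair hc hs, lintegral_withDensity_eq_lintegral_mul _ hcm
      f.continuous.measurable.coe_nnreal_ennreal]
    simp
  refine Measurable.measure_of_isPiSystem
    (BorelSpace.measurable_eq.trans borel_eq_generateFrom_isClosed) isPiSystem_isClosed
    (fun F (hF : IsClosed F) => ?_) ?_
  · exact ENNReal.measurable_of_tendsto (fun k => hint (hF.apprSeq k))
      (tendsto_pi_nhds.2 fun u => HasOuterApproxClosed.tendsto_lintegral_apprSeq hF _)
  · simpa using hint 1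

theorem measurable_toMeasure : Measurable toMeasure := by
  refine Measure.measurable_of_measurable_coe _ fun A hA => ?_
  set K := CompactExhaustion.choice PosReal
  have hK : ∀ n, MeasurableSet (K n) := fun n => (K.isCompact n).measurableSet
  have h : ∀ u : RadonPointMeasure, u.toMeasure A =
      ⨆ n, (u.toMeasure.withDensity fun x => (cutoff n x : ℝ≥0∞)) (A ∩ K n) := by
    intro u
    have h1 : ∀ n, (u.toMeasure.withDensity fun x => (cutoff n x : ℝ≥0∞)) (A ∩ K n) =
        u.toMeasure (A ∩ K n) := fun n => by
      rw [withDensity_apply _ (hA.inter (hK n)), ← setLIntegral_one]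
      refine setLIntegral_congr_fun (hA.inter (hK n)) fun x hx => ?_
      simp [cutoff_eq_one hx.2]
    simp_rw [h1]
    rw [← Monotone.measure_iUnion (fun m n hmn => Set.inter_subset_inter_right A (K.subset hmn)),
      ← Set.inter_iUnion, K.iUnion_eq, Set.inter_univ]
  simp_rw [h]
  exact Measurable.iSup fun n =>
    (Measure.measurable_coe (hA.inter (hK n))).comp (measurable_withDensity_cutoff n)

theorem measurable_lintegral {φ : PosReal → ℝ≥0∞} (hφ : Measurable φ) :
    Measurable fun u : RadonPointMeasure => ∫⁻ x, φ x ∂u.toMeasure :=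
  (Measure.measurable_lintegral hφ).comp measurable_toMeasure

theorem aemeasurable_of_lintegral {Ω : Type*} [MeasurableSpace Ω] {μ : Measure Ω}
    {f : Ω → RadonPointMeasure} (h : ∀ φ : PosReal → ℝ≥0∞, Measurable φ →
      AEMeasurable (fun ω => ∫⁻ x, φ x ∂(f ω).toMeasure) μ) : AEMeasurable f μ :=
  aemeasurable_iff_coords.2 fun j =>
    (h _ (continuous_testFun j).measurable.coe_nnreal_ennreal).ennreal_toNNReal

theorem measurable_of_lintegral {Ω : Type*} [MeasurableSpace Ω] {f : Ω → RadonPointMeasure}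
    (h : ∀ φ : PosReal → ℝ≥0∞, Measurable φ →
      Measurable (fun ω => ∫⁻ x, φ x ∂(f ω).toMeasure)) : Measurable f :=
  measurable_iff_coords.2 (measurable_pi_lambda _ fun j =>
    (h _ (continuous_testFun j).measurable.coe_nnreal_ennreal).ennreal_toNNReal)

theorem pair_add {φ : PosReal → ℝ≥0} (hφ : Continuous φ) (hc : HasCompactSupport φ)
    (u v : RadonPointMeasure) : pair φ (u + v) = pair φ u + pair φ v := by
  rw [pair, toMeasure_add, lintegral_add_measure, ENNReal.toNNReal_add
    (lintegral_testFunction_ne_top hφ hc u) (lintegral_testFunction_ne_top hφ hc v)]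
  rfl

instance : ContinuousAdd RadonPointMeasure := by
  refine ⟨continuous_iff_forall_pair.2 fun φ hφ hc => ?_⟩
  simp_rw [pair_add hφ hc]
  exact ((continuous_pair hφ hc).comp continuous_fst).add
    ((continuous_pair hφ hc).comp continuous_snd)

/-! ### Laplace functionals determine laws -/

/-- The function `x ↦ exp (-∑ c j * x j)` on sequences of nonnegative reals. -/
def expFun {J : Type*} (c : J →₀ ℝ≥0) : BoundedContinuousFunction (J → ℝ≥0) ℝ :=
  BoundedContinuousFunction.ofNormedAddCommGroup
    (fun x => Real.exp (-((c.sum fun j a => a * x j : ℝ≥0) : ℝ)))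
    (Real.continuous_exp.comp (NNReal.continuous_coe.comp
      (continuous_finsetSum _ fun j _ => continuous_const.mul (continuous_apply j))).neg) 1
    (fun x => by
      rw [Real.norm_eq_abs, Real.abs_exp, Real.exp_le_one_iff, neg_nonpos]
      exact NNReal.coe_nonneg _)

theorem expFun_apply {J : Type*} (c : J →₀ ℝ≥0) (x : J → ℝ≥0) :
    expFun c x = Real.exp (-((c.sum fun j a => a * x j : ℝ≥0) : ℝ)) := rfl

theorem expFun_zero {J : Type*} : expFun (0 : J →₀ ℝ≥0) = 1 := by
  ext x; simp [expFun_apply]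

theorem expFun_add {J : Type*} (c d : J →₀ ℝ≥0) : expFun (c + d) = expFun c * expFun d := by
  classical
  ext x
  rw [BoundedContinuousFunction.mul_apply, expFun_apply, expFun_apply, expFun_apply,
    Finsupp.sum_add_index' (by simp) (by intros; ring), NNReal.coe_add, neg_add, Real.exp_add]

/-- A Stone–Weierstrass argument: the exponentials contain 1, are closed under products and separate
points, so their span is a separating algebra on a Polish space. -/
theorem measure_ext_of_integral_expFun {J : Type*} [Countable J] {μ ν : Measure (J → ℝ≥0)}
    [IsFiniteMeasure μ] [IsFiniteMeasure ν]
    (h : ∀ c : J →₀ ℝ≥0, ∫ x, expFun c x ∂μ = ∫ x, expFun c x ∂ν) : μ = ν := by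
  classical
  set S : Submonoid (BoundedContinuousFunction (J → ℝ≥0) ℝ) :=
    { carrier := Set.range expFun
      one_mem' := ⟨0, expFun_zero⟩
      mul_mem' := by
        rintro _ _ ⟨c, rfl⟩ ⟨d, rfl⟩
        exact ⟨c + d, expFun_add c d⟩ } with hS
  let A : StarSubalgebra ℝ (BoundedContinuousFunction (J → ℝ≥0) ℝ) :=
    { Algebra.adjoin ℝ (S : Set (BoundedContinuousFunction (J → ℝ≥0) ℝ)) with
      star_mem' := by
        intro f hf
        have : star f = f := by ext x; simp
        rwa [this] }
  have hA : ∀ f, f ∈ A ↔ f ∈ Submodule.span ℝ (Set.range (expFun (J := J))) := fun f => by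
    have h1 : f ∈ A ↔ f ∈ Algebra.adjoin ℝ (S : Set (BoundedContinuousFunction (J → ℝ≥0) ℝ)) :=
      Iff.rfl
    rw [h1, ← Subalgebra.mem_toSubmodule, Algebra.adjoin_eq_span, Submonoid.closure_eq]
    rfl
  refine ext_of_forall_mem_subalgebra_integral_eq_of_polish (𝕜 := ℝ) (A := A) ?_ ?_
  · intro x y hxy
    obtain ⟨j, hj⟩ := Function.ne_iff.1 hxy
    refine ⟨_, ⟨(expFun (Finsupp.single j 1)).toContinuousMap, ⟨expFun (Finsupp.single j 1),
      (hA _).2 (Submodule.subset_span ⟨_, rfl⟩), rfl⟩, rfl⟩, ?_⟩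
    change expFun _ x ≠ expFun _ y
    simpa [expFun_apply, Finsupp.sum_single_index] using hj
  · intro g hg
    induction (hA g).1 hg using Submodule.span_induction with
    | mem f hf => obtain ⟨c, rfl⟩ := hf; exact h c
    | zero => simp
    | add f g hf hg' ihf ihg =>
      simp only [BoundedContinuousFunction.add_apply]
      rw [integral_add (f.integrable _) (g.integrable _),
        integral_add (f.integrable _) (g.integrable _), ihf ((hA _).2 hf), ihg ((hA _).2 hg')]
    | smul a f hf ih =>
      simp only [BoundedContinuousFunction.smul_apply]
      rw [integral_smul, integral_smul, ih ((hA _).2 hf)]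

/-- Two laws on the space of Radon point measures are equal if their Laplace functionals agree on
the test functions. -/
theorem measure_ext_of_laplace {μ ν : Measure RadonPointMeasure} [IsFiniteMeasure μ]
    [IsFiniteMeasure ν] (h : ∀ φ : PosReal → ℝ≥0, Continuous φ → HasCompactSupport φ →
      ∫⁻ u, negExp (∫⁻ x, φ x ∂u.toMeasure) ∂μ = ∫⁻ u, negExp (∫⁻ x, φ x ∂u.toMeasure) ∂ν) :
    μ = ν := by
  have key : μ.map coords = ν.map coords := by
    refine measure_ext_of_integral_expFun fun c => ?_
    -- A finite nonnegative combination of test functions is again a test function, so the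
    -- hypothesis covers every exponential in the coordinates.
    set φ : PosReal → ℝ≥0 := fun x => c.sum fun j a => a * testFun j x with hφdef
    have hφ : Continuous φ :=
      continuous_finsetSum _ fun j _ => continuous_const.mul (continuous_testFun j)
    have hc : HasCompactSupport φ := by
      rw [hφdef]
      unfold Finsupp.sum
      induction c.support using Finset.induction_on with
      | empty => simpa using! HasCompactSupport.zero (α := PosReal) (β := ℝ≥0)
      | insert a s ha ih =>
        simp only [Finset.sum_insert ha]
        exact (hasCompactSupport_testFun a).mul_left.add ih
    have hpair : ∀ u, ∫⁻ x, φ x ∂u.toMeasure =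
        ((c.sum fun j a => a * coords u j : ℝ≥0) : ℝ≥0∞) := by
      intro u
      simp only [hφdef, Finsupp.sum, ENNReal.ofNNReal_finsetSum, ENNReal.coe_mul]
      rw [lintegral_finsetSum _ fun j _ =>
        ((continuous_testFun j).measurable.coe_nnreal_ennreal).const_mul _]
      refine Finset.sum_congr rfl fun j _ => ?_
      rw [lintegral_const_mul _ (continuous_testFun j).measurable.coe_nnreal_ennreal, coords,
        coe_pair (continuous_testFun j) (hasCompactSupport_testFun j)]
    have hint : ∀ ρ : Measure RadonPointMeasure, ∫ x, expFun c x ∂(ρ.map coords) =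
        (∫⁻ u, negExp (∫⁻ x, φ x ∂u.toMeasure) ∂ρ).toReal := by
      intro ρ
      have hm : Measurable (expFun c) := (expFun c).continuous.measurable
      have hm' : Measurable fun u => expFun c (coords u) := hm.comp measurable_coords
      have hpos : ∀ u, 0 ≤ expFun c (coords u) := fun u => by
        rw [expFun_apply]; exact (Real.exp_pos _).le
      rw [integral_map measurable_coords.aemeasurable hm.aestronglyMeasurable,
        integral_eq_lintegral_of_nonneg_ae (ae_of_all _ hpos) hm'.aestronglyMeasurable]
      congr 1
      refine lintegral_congr fun u => ?_
      rw [hpair, negExp_of_ne_top ENNReal.coe_ne_top, expFun_apply, ENNReal.coe_toReal]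
    rw [hint, hint, h φ hφ hc]
  -- Every Borel set is a preimage under `coords`, so equality of the image measures suffices.
  ext A hA
  change MeasurableSet[borel RadonPointMeasure] A at hA
  rw [borel_eq_comap_coords] at hA
  obtain ⟨B, hB, rfl⟩ := hA
  rw [← Measure.map_apply measurable_coords hB, key, Measure.map_apply measurable_coords hB]

end RadonPointMeasure

/-! ### Countable sums of point measures -/

theorem IsPointMeasure.sum {ι : Type*} [Countable ι] {m : ι → Measure PosReal}
    (h : ∀ i, IsPointMeasure (m i)) : IsPointMeasure (Measure.sum m) := by
  choose κ hκ x hx using h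
  -- `IsPointMeasure` asks for an index type in `Type`, whereas ι may live in any universe;
  -- countability makes the sigma type small.
  let e : (Σ i, κ i) ≃ Shrink.{0} (Σ i, κ i) := equivShrink _
  refine ⟨Shrink.{0} (Σ i, κ i), e.symm.injective.countable,
    fun k => x (e.symm k).1 (e.symm k).2, ?_⟩
  ext A hA
  simp_rw [Measure.sum_apply _ hA]
  rw [e.symm.tsum_eq fun p : Σ i, κ i => Measure.dirac (x p.1 p.2) A,
    ENNReal.tsum_sigma']
  refine tsum_congr fun i => ?_
  rw [hx i, Measure.sum_apply _ hA]

theorem IsRadonPoint.of_le {m m' : Measure PosReal} (h : IsRadonPoint m') (hm : IsPointMeasure m)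
    (hle : m ≤ m') : IsRadonPoint m :=
  ⟨hm, fun K hK => (hle K).trans_lt (h.2 K hK)⟩

theorem isPointMeasure_ite {p : Prop} [Decidable p] (u : RadonPointMeasure) :
    IsPointMeasure (if p then u.toMeasure else 0) := by
  split_ifs
  · exact u.isRadonPoint.1
  · exact isPointMeasure_zero

theorem lintegral_sum_ite {ι : Type*} (p : ι → Prop) [DecidablePred p] (m : ι → Measure PosReal)
    (φ : PosReal → ℝ≥0∞) :
    ∫⁻ x, φ x ∂(Measure.sum fun i => if p i then m i else 0) =
      ∑' i, if p i then ∫⁻ x, φ x ∂(m i) else 0 := by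
  rw [lintegral_sum_measure]
  refine tsum_congr fun i => ?_
  split_ifs <;> simp

theorem sum_ite_le {ι : Type*} (p : ι → Prop) [DecidablePred p] (m : ι → Measure PosReal) :
    (Measure.sum fun i => if p i then m i else 0) ≤ Measure.sum m := by
  refine Measure.le_iff.2 fun A hA => ?_
  rw [Measure.sum_apply _ hA, Measure.sum_apply _ hA]
  refine ENNReal.tsum_le_tsum fun i => ?_
  split_ifs <;> simp

theorem measure_ext_of_lintegral {m m' : Measure PosReal}
    (h : ∀ φ : PosReal → ℝ≥0∞, Measurable φ → ∫⁻ x, φ x ∂m = ∫⁻ x, φ x ∂m') : m = m' := by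
  ext A hA
  rw [← lintegral_indicator_one hA, h _ (measurable_one.indicator hA), lintegral_indicator_one hA]

namespace MarkovProcess

/-! ### The Laplace functional of the process -/

variable {W : Type*} [MeasurableSpace W] (X : MarkovProcess W)

/-- The Laplace functional of the process which starts from a given state, at a given time. -/
def laplace (φ : PosReal → ℝ≥0∞) (t : ℝ≥0) (u : RadonPointMeasure) : ℝ≥0∞ :=
  ∫⁻ w, negExp (∫⁻ x, φ x ∂(X.proc t w).toMeasure) ∂(X.law u)

theorem laplace_le_one (φ : PosReal → ℝ≥0∞) (t : ℝ≥0) (u : RadonPointMeasure) :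
    X.laplace φ t u ≤ 1 :=
  (lintegral_mono fun _ => negExp_le_one _).trans (by simp)

theorem measurable_proc_at (t : ℝ≥0) : Measurable (X.proc t) :=
  X.measurable_proc.comp measurable_prodMk_left

variable {φ : PosReal → ℝ≥0∞}

section

variable (hφ : Measurable φ)

include hφ

theorem measurable_lintegral_proc :
    Measurable fun p : ℝ≥0 × W => ∫⁻ x, φ x ∂(X.proc p.1 p.2).toMeasure :=
  (RadonPointMeasure.measurable_lintegral hφ).comp X.measurable_proc

theorem measurable_lintegral_proc_at (t : ℝ≥0) :
    Measurable fun w => ∫⁻ x, φ x ∂(X.proc t w).toMeasure :=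
  (X.measurable_lintegral_proc hφ).comp measurable_prodMk_left

theorem measurable_laplace (t : ℝ≥0) : Measurable (X.laplace φ t) :=
  (measurable_negExp.comp (X.measurable_lintegral_proc_at hφ t)).lintegral_kernel

theorem measurable_laplace_uncurry :
    Measurable fun p : RadonPointMeasure × ℝ≥0 => X.laplace φ p.2 p.1 := by
  have h : Measurable fun q : (RadonPointMeasure × ℝ≥0) × W =>
      negExp (∫⁻ x, φ x ∂(X.proc q.1.2 q.2).toMeasure) :=
    measurable_negExp.comp ((X.measurable_lintegral_proc hφ).comp
      ((measurable_snd.comp measurable_fst).prodMk measurable_snd))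
  exact h.lintegral_kernel_prod_right' (κ := X.law.comap Prod.fst measurable_fst)

/-- The Markov property with the sure event as past, rewritten as an identity of laws and then
integrated. -/
theorem laplace_add_time (s t : ℝ≥0) (u : RadonPointMeasure) :
    X.laplace φ (s + t) u = ∫⁻ w, X.laplace φ t (X.proc s w) ∂(X.law u) := by
  have hg : Measurable fun v : RadonPointMeasure => negExp (∫⁻ x, φ x ∂v.toMeasure) :=
    measurable_negExp.comp (RadonPointMeasure.measurable_lintegral hφ)
  set κ : Kernel W RadonPointMeasure :=
    (X.law.map (X.proc t)).comap (X.proc s) (X.measurable_proc_at s) with hκ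
  have hmap : (X.law u).map (X.proc (s + t)) = (X.law u).bind κ := by
    ext A hA
    rw [Measure.map_apply (X.measurable_proc_at _) hA, Measure.bind_apply hA κ.aemeasurable]
    have h := X.markov u s t Set.univ A MeasurableSet.univ hA
    rw [Set.univ_inter, Measure.restrict_univ] at h
    refine h.trans (lintegral_congr fun w => ?_)
    rw [hκ, Kernel.comap_apply, Kernel.map_apply' _ (X.measurable_proc_at t) _ hA]
    rfl
  have h1 := lintegral_map (μ := X.law u) hg (X.measurable_proc_at (s + t))
  rw [laplace, ← h1, hmap, Measure.lintegral_bind κ.aemeasurable hg.aemeasurable]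
  refine lintegral_congr fun w => ?_
  rw [hκ, Kernel.comap_apply, Kernel.map_apply _ (X.measurable_proc_at t),
    lintegral_map hg (X.measurable_proc_at t)]
  rfl

theorem laplace_add (hX : X.Superposition) (t : ℝ≥0) (u v : RadonPointMeasure) :
    X.laplace φ t (u + v) = X.laplace φ t u * X.laplace φ t v := by
  have hg : Measurable fun v : RadonPointMeasure => negExp (∫⁻ x, φ x ∂v.toMeasure) :=
    measurable_negExp.comp (RadonPointMeasure.measurable_lintegral hφ)
  have hadd : ∀ t, Measurable fun p : W × W => X.proc t p.1 + X.proc t p.2 := fun t =>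
    ((X.measurable_proc_at t).comp measurable_fst).add
      ((X.measurable_proc_at t).comp measurable_snd)
  have h := congrArg (fun μ : Measure (ℝ≥0 → RadonPointMeasure) =>
    ∫⁻ y, negExp (∫⁻ x, φ x ∂(y t).toMeasure) ∂μ) (hX u v)
  have hgt : Measurable fun y : ℝ≥0 → RadonPointMeasure => negExp (∫⁻ x, φ x ∂(y t).toMeasure) :=
    hg.comp (measurable_pi_apply t)
  rw [lintegral_map hgt (measurable_pi_lambda _ hadd),
    lintegral_map hgt (measurable_pi_lambda _ fun t => X.measurable_proc_at t)] at h
  rw [laplace, ← h]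
  simp only [RadonPointMeasure.toMeasure_add, lintegral_add_measure, negExp_add]
  exact lintegral_prod_mul
    (measurable_negExp.comp (X.measurable_lintegral_proc_at hφ t)).aemeasurable
    (measurable_negExp.comp (X.measurable_lintegral_proc_at hφ t)).aemeasurable

end

/-- Test functions have finite integrals, so the integrand is positive. This makes the logarithm
finite, as the countable additivity argument requires. -/
theorem laplace_ne_zero {φ : PosReal → ℝ≥0} (hφ : Continuous φ) (hc : HasCompactSupport φ)
    (t : ℝ≥0) (u : RadonPointMeasure) : X.laplace (fun x => φ x) t u ≠ 0 := by
  have hm : Measurable fun w => negExp (∫⁻ x, φ x ∂(X.proc t w).toMeasure) :=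
    measurable_negExp.comp (X.measurable_lintegral_proc_at hφ.measurable.coe_nnreal_ennreal t)
  intro h
  rw [laplace, lintegral_eq_zero_iff hm] at h
  obtain ⟨w, hw⟩ := h.exists
  exact RadonPointMeasure.lintegral_testFunction_ne_top hφ hc _ (negExp_eq_zero_iff.1 hw)

/-- The superposition property extends to countable sums. -/
theorem laplace_sum (hX : X.Superposition) {φ : PosReal → ℝ≥0} (hφ : Continuous φ)
    (hc : HasCompactSupport φ) (t : ℝ≥0) {ι : Type*} [Countable ι] {v : ι → RadonPointMeasure}
    {u : RadonPointMeasure} (hu : u.toMeasure = Measure.sum fun i => (v i).toMeasure) :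
    X.laplace (fun x => φ x) t u = negExp (∑' i, negLog (X.laplace (fun x => φ x) t (v i))) := by
  classical
  have hφm : Measurable fun x => (φ x : ℝ≥0∞) := hφ.measurable.coe_nnreal_ennreal
  -- `U S` is the partial sum over `S`. It is Radon because it is dominated by `u`.
  set U : (ι → Bool) → RadonPointMeasure := fun S =>
    RadonPointMeasure.ofMeasure (Measure.sum fun i => if S i then (v i).toMeasure else 0) with hU
  have hUm : ∀ S, (U S).toMeasure = Measure.sum fun i => if S i then (v i).toMeasure else 0 :=
    fun S => RadonPointMeasure.toMeasure_ofMeasure (u.isRadonPoint.of_le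
      (IsPointMeasure.sum fun i => isPointMeasure_ite _) (hu ▸ sum_ite_le _ _))
  have hUi : ∀ S (ψ : PosReal → ℝ≥0∞), ∫⁻ x, ψ x ∂(U S).toMeasure =
      ∑' i, if S i then ∫⁻ x, ψ x ∂(v i).toMeasure else 0 := fun S ψ => by
    rw [hUm, lintegral_sum_ite]
  have hUtrue : U (fun _ => true) = u := by
    ext1; rw [hUm, hu]; simp
  have hUsingle : ∀ i, U (fun j => decide (j = i)) = v i := fun i => by
    ext1
    refine measure_ext_of_lintegral fun ψ _ => ?_
    rw [hUi, tsum_eq_single i fun j hj => by simp [hj]]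
    simp
  have hUadd : ∀ S T : ι → Bool, (∀ i, (S i && T i) = false) →
      U (fun i => S i || T i) = U S + U T := by
    intro S T h
    ext1
    refine measure_ext_of_lintegral fun ψ _ => ?_
    rw [RadonPointMeasure.toMeasure_add, lintegral_add_measure, hUi, hUi, hUi, ← ENNReal.tsum_add]
    refine tsum_congr fun i => ?_
    have := h i
    cases hS : S i <;> cases hT : T i <;> simp_all
  have hUmeas : Measurable U := by
    refine RadonPointMeasure.measurable_of_lintegral fun ψ _ => ?_
    simp_rw [hUi]
    refine Measurable.tsum fun i => Measurable.ite ?_ measurable_const measurable_const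
    exact measurable_pi_apply (X := fun _ : ι => Bool) i (measurableSet_singleton true)
  -- Superposition for two summands makes minus the logarithm of the Laplace functional of `U S`
  -- finitely additive in `S`.
  have h := eq_tsum_of_additive_of_measurable
    (m := fun S => negLog (X.laplace (fun x => φ x) t (U S)))
    (measurable_negLog.comp ((X.measurable_laplace hφm t).comp hUmeas))
    (negLog_ne_top (X.laplace_le_one _ _ _) (X.laplace_ne_zero hφ hc _ _))
    (fun S T hST => by
      rw [hUadd S T hST, X.laplace_add hφm hX,
        negLog_mul (X.laplace_le_one _ _ _) (X.laplace_le_one _ _ _)])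
  simp only [hUtrue, hUsingle] at h
  rw [← h, negExp_negLog (X.laplace_le_one _ _ _)]

end MarkovProcess

/-! ### Lebesgue measure on the nonnegative reals -/

/-- Lebesgue measure on the nonnegative reals. -/
abbrev timeMeasure : Measure ℝ≥0 := (volume : Measure ℝ).comap ((↑) : ℝ≥0 → ℝ)

theorem measurableEmbedding_coe_nnreal : MeasurableEmbedding ((↑) : ℝ≥0 → ℝ) :=
  MeasurableEmbedding.subtype_coe measurableSet_Ici

theorem map_coe_timeMeasure :
    timeMeasure.map ((↑) : ℝ≥0 → ℝ) = volume.restrict (Set.Ici (0 : ℝ)) := by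
  rw [measurableEmbedding_coe_nnreal.map_comap]
  congr 1
  exact Subtype.range_coe

instance : SigmaFinite timeMeasure :=
  SigmaFinite.of_map timeMeasure measurableEmbedding_coe_nnreal.measurable.aemeasurable
    (map_coe_timeMeasure ▸ inferInstance)

theorem lintegral_timeMeasure (ψ : ℝ≥0 → ℝ≥0∞) :
    ∫⁻ r, ψ r ∂timeMeasure = ∫⁻ x, (Set.Ici (0 : ℝ)).indicator (fun x => ψ x.toNNReal) x := by
  rw [lintegral_indicator measurableSet_Ici]
  rw [← map_coe_timeMeasure, measurableEmbedding_coe_nnreal.lintegral_map]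
  simp

theorem lintegral_timeMeasure_sub (t : ℝ≥0) (ψ : ℝ≥0 → ℝ≥0∞) :
    ∫⁻ r, (if r ≤ t then ψ (t - r) else 0) ∂timeMeasure =
      ∫⁻ r, (if r ≤ t then ψ r else 0) ∂timeMeasure := by
  rw [lintegral_timeMeasure, lintegral_timeMeasure, ← lintegral_sub_left_eq_self _ (t : ℝ)]
  refine lintegral_congr fun x => ?_
  by_cases hx : 0 ≤ x <;> by_cases hxt : x ≤ t
  · have h1 : x.toNNReal ≤ t := Real.toNNReal_le_iff_le_coe.2 hxt
    have h2 : (t - x).toNNReal ≤ t := Real.toNNReal_le_iff_le_coe.2 (by linarith)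
    have h3 : t - (t - x).toNNReal = x.toNNReal := by
      ext
      rw [NNReal.coe_sub h2, Real.coe_toNNReal _ (by linarith), Real.coe_toNNReal _ hx]
      ring
    have h4 : t - x.toNNReal = (t - x).toNNReal := by
      ext
      rw [NNReal.coe_sub h1, Real.coe_toNNReal _ hx, Real.coe_toNNReal _ (by linarith)]
    rw [Set.indicator_of_mem (by simpa using hxt), Set.indicator_of_mem (by simpa using hx),
      if_pos h2, if_pos h1, h3]
  · have h1 : ¬ x.toNNReal ≤ t := fun h => hxt (Real.toNNReal_le_iff_le_coe.1 h)
    rw [Set.indicator_of_notMem (by simpa using hxt), Set.indicator_of_mem (by simpa using hx),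
      if_neg h1]
  · have h1 : ¬ (t - x).toNNReal ≤ t := fun h => hx (by
      have := Real.toNNReal_le_iff_le_coe.1 h; linarith)
    rw [Set.indicator_of_mem (by simpa using hxt), Set.indicator_of_notMem (by simpa using hx),
      if_neg h1]
  · exact absurd (le_of_not_ge hx |>.trans t.coe_nonneg) hxt

theorem lintegral_timeMeasure_add (t : ℝ≥0) {ψ : ℝ≥0 → ℝ≥0∞} (hψ : Measurable ψ) :
    ∫⁻ r, (if r ≤ t then ψ r else 0) ∂timeMeasure + ∫⁻ r, ψ (r + t) ∂timeMeasure =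
      ∫⁻ r, ψ r ∂timeMeasure := by
  have h1 : ∫⁻ r, ψ (r + t) ∂timeMeasure =
      ∫⁻ x, (Set.Ici (t : ℝ)).indicator (fun x => ψ x.toNNReal) x := by
    rw [lintegral_timeMeasure, ← lintegral_add_right_eq_self
      ((Set.Ici (t : ℝ)).indicator fun x => ψ x.toNNReal) (t : ℝ)]
    refine lintegral_congr fun x => ?_
    simp only [Set.indicator_apply, Set.mem_Ici, le_add_iff_nonneg_left]
    by_cases hx : 0 ≤ x
    · rw [if_pos hx, if_pos hx, Real.toNNReal_add hx t.coe_nonneg, Real.toNNReal_coe]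
    · rw [if_neg hx, if_neg hx]
  have hm : Measurable fun x : ℝ => ψ x.toNNReal := hψ.comp measurable_real_toNNReal
  rw [h1, lintegral_timeMeasure, lintegral_timeMeasure,
    ← lintegral_add_right _ (hm.indicator measurableSet_Ici)]
  -- The pieces r ≤ t and r ≥ t overlap only at the null point t.
  have hne : ∀ᵐ x : ℝ, x ≠ t := by simp [ae_iff]
  refine lintegral_congr_ae ?_
  filter_upwards [hne] with x hx
  simp only [Set.indicator_apply, Set.mem_Ici, Real.toNNReal_le_iff_le_coe]
  by_cases h0 : 0 ≤ x
  · rw [if_pos h0, if_pos h0]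
    rcases lt_or_gt_of_ne hx with h | h
    · rw [if_pos h.le, if_neg (not_le.2 h), add_zero]
    · rw [if_neg (not_le.2 h), if_pos h.le, zero_add]
  · rw [if_neg h0, if_neg h0, if_neg (not_le.2 ((lt_of_not_ge h0).trans_le t.coe_nonneg)),
      add_zero]

/-! ### Sums over the immigrants -/

section

variable {W ι Ω : Type*} [MeasurableSpace W]

/-- The sum over the immigrants up to time `t` of the process started at the immigrant and
evaluated at the immigration time. -/
def truncSum (X : MarkovProcess W) (τ : ι → Ω → ℝ≥0) (ξ : ι → Ω → W) (t : ℝ≥0) (ω : Ω) :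
    Measure PosReal :=
  Measure.sum fun i => if τ i ω ≤ t then (X.proc (τ i ω) (ξ i ω)).toMeasure else 0

section sums

variable (X : MarkovProcess W) (τ : ι → Ω → ℝ≥0) (ξ : ι → Ω → W)

theorem lintegral_immigrantSum (φ : PosReal → ℝ≥0∞) (t : ℝ≥0) (ω : Ω) :
    ∫⁻ x, φ x ∂(immigrantSum X τ ξ t ω) =
      ∑' i, if τ i ω ≤ t then ∫⁻ x, φ x ∂(X.proc (t - τ i ω) (ξ i ω)).toMeasure else 0 :=
  lintegral_sum_ite _ _ _

theorem lintegral_truncSum (φ : PosReal → ℝ≥0∞) (t : ℝ≥0) (ω : Ω) :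
    ∫⁻ x, φ x ∂(truncSum X τ ξ t ω) =
      ∑' i, if τ i ω ≤ t then ∫⁻ x, φ x ∂(X.proc (τ i ω) (ξ i ω)).toMeasure else 0 :=
  lintegral_sum_ite _ _ _

theorem lintegral_statSum (φ : PosReal → ℝ≥0∞) (ω : Ω) :
    ∫⁻ x, φ x ∂(statSum X τ ξ ω) = ∑' i, ∫⁻ x, φ x ∂(X.proc (τ i ω) (ξ i ω)).toMeasure :=
  lintegral_sum_measure _ _

theorem truncSum_le_statSum (t : ℝ≥0) (ω : Ω) : truncSum X τ ξ t ω ≤ statSum X τ ξ ω :=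
  sum_ite_le _ _

theorem tendsto_lintegral_truncSum (φ : PosReal → ℝ≥0∞) (ω : Ω) :
    Tendsto (fun t => ∫⁻ x, φ x ∂(truncSum X τ ξ t ω)) atTop
      (𝓝 (∫⁻ x, φ x ∂(statSum X τ ξ ω))) := by
  classical
  have hmono : Monotone fun t => ∫⁻ x, φ x ∂(truncSum X τ ξ t ω) := by
    intro t t' h
    simp only [lintegral_truncSum]
    refine ENNReal.tsum_le_tsum fun i => ?_
    by_cases hi : τ i ω ≤ t
    · rw [if_pos hi, if_pos (hi.trans h)]
    · rw [if_neg hi]; exact zero_le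
  have hsup : ∫⁻ x, φ x ∂(statSum X τ ξ ω) = ⨆ t, ∫⁻ x, φ x ∂(truncSum X τ ξ t ω) := by
    refine le_antisymm ?_ (iSup_le fun t => lintegral_mono' (truncSum_le_statSum X τ ξ t ω) le_rfl)
    rw [lintegral_statSum, ENNReal.tsum_eq_iSup_sum]
    refine iSup_le fun J => ?_
    -- A finite set of immigrants is complete by the latest of its arrival times.
    refine le_iSup_of_le (J.sup fun i => τ i ω) ?_
    rw [lintegral_truncSum]
    refine le_trans (Finset.sum_le_sum fun i hi => ?_) (ENNReal.sum_le_tsum J)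
    rw [if_pos (Finset.le_sup (f := fun i => τ i ω) hi)]
  rw [hsup]
  exact tendsto_atTop_iSup hmono

end sums

section measurability

variable [MeasurableSpace Ω] [Countable ι] {X : MarkovProcess W} {τ : ι → Ω → ℝ≥0} {ξ : ι → Ω → W}
  (hτ : ∀ i, Measurable (τ i)) (hξ : ∀ i, Measurable (ξ i)) {φ : PosReal → ℝ≥0∞}
  (hφ : Measurable φ)

include hτ hξ hφ

theorem measurable_lintegral_immigrantSum (t : ℝ≥0) :
    Measurable fun ω => ∫⁻ x, φ x ∂(immigrantSum X τ ξ t ω) := by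
  simp_rw [lintegral_immigrantSum]
  refine Measurable.tsum fun i =>
    Measurable.ite (measurableSet_le (hτ i) measurable_const) ?_ measurable_const
  exact (X.measurable_lintegral_proc hφ).comp ((measurable_const.sub (hτ i)).prodMk (hξ i))

theorem measurable_lintegral_truncSum (t : ℝ≥0) :
    Measurable fun ω => ∫⁻ x, φ x ∂(truncSum X τ ξ t ω) := by
  simp_rw [lintegral_truncSum]
  refine Measurable.tsum fun i =>
    Measurable.ite (measurableSet_le (hτ i) measurable_const) ?_ measurable_const
  exact (X.measurable_lintegral_proc hφ).comp ((hτ i).prodMk (hξ i))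

theorem measurable_lintegral_statSum :
    Measurable fun ω => ∫⁻ x, φ x ∂(statSum X τ ξ ω) := by
  simp_rw [lintegral_statSum]
  exact Measurable.tsum fun i => (X.measurable_lintegral_proc hφ).comp ((hτ i).prodMk (hξ i))

end measurability

section pointMeasures

variable [Countable ι] (X : MarkovProcess W) (τ : ι → Ω → ℝ≥0) (ξ : ι → Ω → W)

theorem isPointMeasure_truncSum (t : ℝ≥0) (ω : Ω) : IsPointMeasure (truncSum X τ ξ t ω) :=
  IsPointMeasure.sum fun _ => isPointMeasure_ite _

theorem isPointMeasure_statSum (ω : Ω) : IsPointMeasure (statSum X τ ξ ω) :=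
  IsPointMeasure.sum fun i => (X.proc (τ i ω) (ξ i ω)).isRadonPoint.1

end pointMeasures

theorem aemeasurable_ofMeasure {Ω' : Type*} [MeasurableSpace Ω'] {μ : Measure Ω'}
    {m : Ω' → Measure PosReal} (hm : ∀ φ : PosReal → ℝ≥0∞, Measurable φ →
      AEMeasurable (fun ω => ∫⁻ x, φ x ∂(m ω)) μ) (h : ∀ᵐ ω ∂μ, IsRadonPoint (m ω)) :
    AEMeasurable (fun ω => RadonPointMeasure.ofMeasure (m ω)) μ := by
  refine RadonPointMeasure.aemeasurable_of_lintegral fun φ hφ => (hm φ hφ).congr ?_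
  filter_upwards [h] with ω hω
  rw [RadonPointMeasure.toMeasure_ofMeasure hω]

/-! ### Laplace functionals of sums over the immigrants -/

namespace IsImmigration

variable [MeasurableSpace Ω] {X : MarkovProcess W} {I : Measure RadonPointMeasure}
  {P : Measure Ω} {s : ι → Ω → RadonPointMeasure} {τ : ι → Ω → ℝ≥0}
  {ξ : ι → Ω → W} (himm : IsImmigration X I P s τ ξ)

include himm

theorem measurable_time (i : ι) : Measurable (τ i) :=
  measurable_snd.comp (himm.poisson.measurable i)

variable [Countable ι] [SigmaFinite I] [IsProbabilityMeasure P]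

theorem lintegral_negExp_tsum {f : ℝ≥0 × W → ℝ≥0∞} (hf : Measurable f) :
    ∫⁻ ω, negExp (∑' i, f (τ i ω, ξ i ω)) ∂P =
      negExp (∫⁻ v, ∫⁻ r, 1 - ∫⁻ w, negExp (f (r, w)) ∂(X.law v) ∂timeMeasure ∂I) := by
  have hf' : Measurable fun q : (RadonPointMeasure × ℝ≥0) × W => f (q.1.2, q.2) :=
    hf.comp ((measurable_snd.comp measurable_fst).prodMk measurable_snd)
  have h := himm.poisson.lintegral_negExp_marks
    (κ := X.law.comap Prod.fst measurable_fst) himm.measurable himm.cond_indep hf'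
  refine h.trans ?_
  have hk : Measurable fun a : RadonPointMeasure × ℝ≥0 =>
      1 - ∫⁻ w, negExp (f (a.2, w)) ∂(X.law a.1) :=
    measurable_const.sub ((measurable_negExp.comp hf').lintegral_kernel_prod_right'
      (κ := X.law.comap Prod.fst measurable_fst))
  exact congrArg negExp (lintegral_prod _ hk.aemeasurable)

variable {φ : PosReal → ℝ≥0∞} (hφ : Measurable φ)

include hφ

theorem lintegral_negExp_statSum :
    ∫⁻ ω, negExp (∫⁻ x, φ x ∂(statSum X τ ξ ω)) ∂P =
      negExp (∫⁻ v, ∫⁻ r, 1 - X.laplace φ r v ∂timeMeasure ∂I) := by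
  simp_rw [lintegral_statSum]
  exact himm.lintegral_negExp_tsum (X.measurable_lintegral_proc hφ)

theorem lintegral_negExp_truncSum (t : ℝ≥0) :
    ∫⁻ ω, negExp (∫⁻ x, φ x ∂(truncSum X τ ξ t ω)) ∂P =
      negExp (∫⁻ v, ∫⁻ r, (if r ≤ t then 1 - X.laplace φ r v else 0) ∂timeMeasure ∂I) := by
  simp_rw [lintegral_truncSum]
  refine (himm.lintegral_negExp_tsum
    (f := fun p => if p.1 ≤ t then ∫⁻ x, φ x ∂(X.proc p.1 p.2).toMeasure else 0)
    (Measurable.ite (measurableSet_le measurable_fst measurable_const)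
      (X.measurable_lintegral_proc hφ) measurable_const)).trans ?_
  refine congrArg negExp (lintegral_congr fun v => lintegral_congr fun r => ?_)
  by_cases hr : r ≤ t <;> simp [hr, MarkovProcess.laplace]

/-- Arrival at r leaves the age t - r, and r ↦ t - r preserves Lebesgue measure on [0, t]. The
equality concerns a single time, not the processes. -/
theorem lintegral_negExp_immigrantSum (t : ℝ≥0) :
    ∫⁻ ω, negExp (∫⁻ x, φ x ∂(immigrantSum X τ ξ t ω)) ∂P =
      ∫⁻ ω, negExp (∫⁻ x, φ x ∂(truncSum X τ ξ t ω)) ∂P := by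
  rw [himm.lintegral_negExp_truncSum hφ]
  simp_rw [lintegral_immigrantSum]
  refine (himm.lintegral_negExp_tsum
    (f := fun p => if p.1 ≤ t then ∫⁻ x, φ x ∂(X.proc (t - p.1) p.2).toMeasure else 0)
    (Measurable.ite (measurableSet_le measurable_fst measurable_const)
      ((X.measurable_lintegral_proc hφ).comp
        ((measurable_const.sub measurable_fst).prodMk measurable_snd)) measurable_const)).trans ?_
  refine congrArg negExp (lintegral_congr fun v => ?_)
  rw [← lintegral_timeMeasure_sub]
  refine lintegral_congr fun r => ?_
  by_cases hr : r ≤ t <;> simp [hr, MarkovProcess.laplace]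

/-- The exponent is cut at t and its tail shifted by t; the Markov property turns 1 - L_{r+t} into
the exponent of the first factor. Superposition is needed only later, to read that factor as the
evolution of `statSum` during time t. -/
theorem lintegral_negExp_statSum_eq_mul (t : ℝ≥0) :
    ∫⁻ ω, negExp (∫⁻ x, φ x ∂(statSum X τ ξ ω)) ∂P =
      (∫⁻ ω, negExp (∑' i, negLog (X.laplace φ t (X.proc (τ i ω) (ξ i ω)))) ∂P) *
        ∫⁻ ω, negExp (∫⁻ x, φ x ∂(truncSum X τ ξ t ω)) ∂P := by
  have hm : Measurable fun p : RadonPointMeasure × ℝ≥0 => 1 - X.laplace φ p.2 p.1 :=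
    measurable_const.sub (X.measurable_laplace_uncurry hφ)
  rw [himm.lintegral_negExp_truncSum hφ, himm.lintegral_negExp_statSum hφ,
    himm.lintegral_negExp_tsum (f := fun p => negLog (X.laplace φ t (X.proc p.1 p.2)))
      (measurable_negLog.comp ((X.measurable_laplace hφ t).comp X.measurable_proc)),
    mul_comm, ← negExp_add, ← lintegral_add_left]
  · refine congrArg negExp (lintegral_congr fun v => ?_)
    have hv : Measurable fun r => 1 - X.laplace φ r v := hm.comp measurable_prodMk_left
    rw [← lintegral_timeMeasure_add t hv]
    refine congrArg₂ _ rfl (lintegral_congr fun r => ?_)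
    simp_rw [negExp_negLog (X.laplace_le_one _ _ _), ← X.laplace_add_time hφ]
  · refine Measurable.lintegral_prod_right' (f := fun p : RadonPointMeasure × ℝ≥0 =>
      if p.2 ≤ t then 1 - X.laplace φ p.2 p.1 else 0) ?_
    exact Measurable.ite (measurableSet_le measurable_snd measurable_const) hm measurable_const

end IsImmigration

end

/-! ### Limits and laws of the process with immigration -/

section

variable {W ι Ω : Type*} [MeasurableSpace W] {X : MarkovProcess W} {τ : ι → Ω → ℝ≥0}
  {ξ : ι → Ω → W}

theorem tendsto_ofMeasure_truncSum [Countable ι] {ω : Ω} (hω : IsRadonPoint (statSum X τ ξ ω)) :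
    Tendsto (fun t => RadonPointMeasure.ofMeasure (truncSum X τ ξ t ω)) atTop
      (𝓝 (RadonPointMeasure.ofMeasure (statSum X τ ξ ω))) := by
  rw [RadonPointMeasure.isInducing_coords.tendsto_nhds_iff, tendsto_pi_nhds]
  intro j
  have hj := RadonPointMeasure.lintegral_testFunction_ne_top
    (RadonPointMeasure.continuous_testFun j) (RadonPointMeasure.hasCompactSupport_testFun j)
    (RadonPointMeasure.ofMeasure (statSum X τ ξ ω))
  rw [RadonPointMeasure.toMeasure_ofMeasure hω] at hj
  have h := (ENNReal.tendsto_toNNReal hj).comp (tendsto_lintegral_truncSum X τ ξ _ ω)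
  simp only [Function.comp_def, RadonPointMeasure.coords, RadonPointMeasure.pair,
    RadonPointMeasure.toMeasure_ofMeasure hω]
  refine h.congr fun t => ?_
  rw [Function.comp_apply, RadonPointMeasure.toMeasure_ofMeasure
    (hω.of_le (isPointMeasure_truncSum X τ ξ t ω) (truncSum_le_statSum X τ ξ t ω))]

variable [MeasurableSpace Ω] {I : Measure RadonPointMeasure} {P : Measure Ω}
  {s : ι → Ω → RadonPointMeasure}

theorem IsImmigration.aemeasurable_ofMeasure_statSum [Countable ι]
    (himm : IsImmigration X I P s τ ξ)
    (hstat : ∀ᵐ ω ∂P, IsRadonPoint (statSum X τ ξ ω)) :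
    AEMeasurable (fun ω => RadonPointMeasure.ofMeasure (statSum X τ ξ ω)) P :=
  aemeasurable_ofMeasure (fun _ hφ =>
    (measurable_lintegral_statSum himm.measurable_time himm.measurable hφ).aemeasurable) hstat

section immigrationProc

variable (hsum : ∀ᵐ ω ∂P, ∀ t : ℝ≥0, IsRadonPoint (immigrantSum X τ ξ t ω))
  (π : Measure RadonPointMeasure)

include hsum

theorem ae_isRadonPoint_immigrationProc [SFinite P] (t : ℝ≥0) : ∀ᵐ p ∂(immigrationLaw X P π),
    IsRadonPoint ((X.proc t p.1).toMeasure + immigrantSum X τ ξ t p.2) := by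
  have h : ∀ᵐ p ∂(immigrationLaw X P π), ∀ t : ℝ≥0, IsRadonPoint (immigrantSum X τ ξ t p.2) :=
    Measure.quasiMeasurePreserving_snd.ae hsum
  filter_upwards [h] with p hp using (X.proc t p.1).isRadonPoint.add (hp t)

variable [Countable ι] [IsProbabilityMeasure P]

theorem aemeasurable_immigrationProc (hτ : ∀ i, Measurable (τ i)) (hξ : ∀ i, Measurable (ξ i))
    (t : ℝ≥0) : AEMeasurable (immigrationProc X τ ξ t) (immigrationLaw X P π) := by
  refine aemeasurable_ofMeasure (fun φ hφ => ?_) (ae_isRadonPoint_immigrationProc hsum π t)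
  simp_rw [lintegral_add_measure]
  exact (((X.measurable_lintegral_proc_at hφ t).comp measurable_fst).add
    ((measurable_lintegral_immigrantSum hτ hξ hφ t).comp measurable_snd)).aemeasurable

theorem lintegral_negExp_immigrationProc [IsProbabilityMeasure π] (hτ : ∀ i, Measurable (τ i))
    (hξ : ∀ i, Measurable (ξ i)) (t : ℝ≥0) {φ : PosReal → ℝ≥0∞} (hφ : Measurable φ) :
    ∫⁻ u, negExp (∫⁻ x, φ x ∂u.toMeasure) ∂(immigrationLaw X P π).map (immigrationProc X τ ξ t) =
      (∫⁻ u, X.laplace φ t u ∂π) *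
        ∫⁻ ω, negExp (∫⁻ x, φ x ∂(immigrantSum X τ ξ t ω)) ∂P := by
  have hg : Measurable fun u : RadonPointMeasure => negExp (∫⁻ x, φ x ∂u.toMeasure) :=
    measurable_negExp.comp (RadonPointMeasure.measurable_lintegral hφ)
  have h1 : Measurable fun w => negExp (∫⁻ x, φ x ∂(X.proc t w).toMeasure) :=
    measurable_negExp.comp (X.measurable_lintegral_proc_at hφ t)
  have h2 : Measurable fun ω => negExp (∫⁻ x, φ x ∂(immigrantSum X τ ξ t ω)) :=
    measurable_negExp.comp (measurable_lintegral_immigrantSum hτ hξ hφ t)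
  rw [lintegral_map' hg.aemeasurable (aemeasurable_immigrationProc hsum π hτ hξ t)]
  have h3 : ∫⁻ p, negExp (∫⁻ x, φ x ∂(immigrationProc X τ ξ t p).toMeasure)
      ∂(immigrationLaw X P π) = ∫⁻ p, negExp (∫⁻ x, φ x ∂(X.proc t p.1).toMeasure) *
        negExp (∫⁻ x, φ x ∂(immigrantSum X τ ξ t p.2)) ∂(immigrationLaw X P π) := by
    refine lintegral_congr_ae ?_
    filter_upwards [ae_isRadonPoint_immigrationProc hsum π t] with p hp
    rw [immigrationProc, RadonPointMeasure.toMeasure_ofMeasure hp, lintegral_add_measure,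
      negExp_add]
  rw [h3, lintegral_prod_mul h1.aemeasurable h2.aemeasurable,
    Measure.lintegral_bind X.law.aemeasurable h1.aemeasurable]
  rfl

end immigrationProc

variable [Countable ι] [SigmaFinite I] [IsProbabilityMeasure P]

/-- As c tends to 0, exp(-cF) tends to the indicator of finiteness of F. -/
theorem tendsto_lintegral_negExp_inv_mul {Ω' : Type*} [MeasurableSpace Ω'] {Q : Measure Ω'}
    [IsFiniteMeasure Q] {F : Ω' → ℝ≥0∞} (hF : Measurable F) :
    Tendsto (fun n : ℕ => ∫⁻ y, negExp ((n : ℝ≥0∞)⁻¹ * F y) ∂Q) atTop (𝓝 (Q {y | F y ≠ ∞})) := by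
  have hA : MeasurableSet {y | F y ≠ ∞} := (hF (measurableSet_singleton ∞)).compl
  rw [← lintegral_indicator_one hA]
  refine tendsto_lintegral_of_dominated_convergence (fun _ => 1)
    (fun n => measurable_negExp.comp (hF.const_mul _))
    (fun n => ae_of_all _ fun y => negExp_le_one _) (by simp) (ae_of_all _ fun y => ?_)
  by_cases hy : F y = ∞
  · rw [Set.indicator_of_notMem (by simpa using hy)]
    refine tendsto_const_nhds.congr fun n => ?_
    rw [hy, ENNReal.mul_top (ENNReal.inv_ne_zero.2 (ENNReal.natCast_ne_top n)), negExp_top]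
  · rw [Set.indicator_of_mem (by exact hy)]
    have h := ENNReal.Tendsto.mul_const (b := F y) ENNReal.tendsto_inv_nat_nhds_zero (Or.inr hy)
    rw [zero_mul] at h
    simpa [Function.comp_def] using (continuous_negExp.tendsto _).comp h

/-! ### Consequences of the existence of a stationary distribution -/

/-- Under π the state at time t contains the immigrants, so the functional of π is at most that of
the truncated sum. The limit t → ∞ reaches `statSum`, and scaling φ by 1/n turns the inequality into
one between probabilities of finiteness. -/
theorem IsImmigration.ae_lintegral_statSum_ne_top (himm : IsImmigration X I P s τ ξ)
    (hsum : ∀ᵐ ω ∂P, ∀ t : ℝ≥0, IsRadonPoint (immigrantSum X τ ξ t ω))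
    {π : Measure RadonPointMeasure} (hπ : IsStationary X τ ξ P π) {φ : PosReal → ℝ≥0∞}
    (hφ : Measurable φ) (hfin : ∀ᵐ u ∂π, ∫⁻ x, φ x ∂u.toMeasure ≠ ∞) :
    ∀ᵐ ω ∂P, ∫⁻ x, φ x ∂(statSum X τ ξ ω) ≠ ∞ := by
  have := hπ.1
  have hτ := himm.measurable_time
  have hξ := himm.measurable
  have hle : ∀ c : ℝ≥0∞, ∫⁻ u, negExp (c * ∫⁻ x, φ x ∂u.toMeasure) ∂π ≤
      ∫⁻ ω, negExp (c * ∫⁻ x, φ x ∂(statSum X τ ξ ω)) ∂P := by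
    intro c
    have hcφ : Measurable fun x => c * φ x := hφ.const_mul c
    simp_rw [← lintegral_const_mul c hφ]
    have htrunc : ∀ t : ℝ≥0, ∫⁻ u, negExp (∫⁻ x, c * φ x ∂u.toMeasure) ∂π ≤
        ∫⁻ ω, negExp (∫⁻ x, c * φ x ∂(truncSum X τ ξ t ω)) ∂P := by
      intro t
      conv_lhs => rw [← hπ.2 t]
      rw [lintegral_negExp_immigrationProc hsum π hτ hξ t hcφ,
        himm.lintegral_negExp_immigrantSum hcφ]
      -- Discarding the initial population amounts to dropping a factor at most one.
      refine mul_le_of_le_one_left zero_le ?_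
      exact (lintegral_mono fun u => X.laplace_le_one _ t u).trans (by simp)
    refine ge_of_tendsto' (tendsto_lintegral_negExp
      (fun n : ℕ => measurable_lintegral_truncSum hτ hξ hcφ (n : ℝ≥0)) (ae_of_all _ fun ω =>
        (tendsto_lintegral_truncSum X τ ξ _ ω).comp tendsto_natCast_atTop_atTop)) fun n => ?_
    exact htrunc n
  have hstat := measurable_lintegral_statSum (X := X) hτ hξ hφ
  have h1 := le_of_tendsto_of_tendsto'
    (tendsto_lintegral_negExp_inv_mul (RadonPointMeasure.measurable_lintegral hφ))
    (tendsto_lintegral_negExp_inv_mul hstat) fun n => hle (n : ℝ≥0∞)⁻¹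
  have h2 : π {u | ∫⁻ x, φ x ∂u.toMeasure ≠ ∞} = 1 := by
    exact (mem_ae_iff_prob_eq_one
      ((RadonPointMeasure.measurable_lintegral hφ) (measurableSet_singleton ∞)).compl).1 hfin
  rw [h2] at h1
  exact (mem_ae_iff_prob_eq_one (hstat (measurableSet_singleton ∞)).compl).2
    (le_antisymm prob_le_one h1)

/-- A compact exhaustion reduces local finiteness to countably many almost sure statements. -/
theorem IsRadonPoint.statSum_of_isStationary (himm : IsImmigration X I P s τ ξ)
    (hsum : ∀ᵐ ω ∂P, ∀ t : ℝ≥0, IsRadonPoint (immigrantSum X τ ξ t ω))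
    {π : Measure RadonPointMeasure} (hπ : IsStationary X τ ξ P π) :
    ∀ᵐ ω ∂P, IsRadonPoint (statSum X τ ξ ω) := by
  set K := CompactExhaustion.choice PosReal
  have hK : ∀ n, MeasurableSet (K n) := fun n => (K.isCompact n).measurableSet
  have h : ∀ n, ∀ᵐ ω ∂P, statSum X τ ξ ω (K n) ≠ ∞ := by
    intro n
    have h1 := himm.ae_lintegral_statSum_ne_top hsum hπ
      (φ := (K n).indicator 1) (measurable_one.indicator (hK n)) (ae_of_all _ fun u => by
        rw [lintegral_indicator_one (hK n)]
        exact (u.isRadonPoint.2 _ (K.isCompact n)).ne)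
    simpa only [lintegral_indicator_one (hK n)] using h1
  filter_upwards [ae_all_iff.2 h] with ω hω
  refine ⟨isPointMeasure_statSum X τ ξ ω, fun C hC => ?_⟩
  obtain ⟨n, hn⟩ := K.exists_superset_of_isCompact hC
  exact (measure_mono hn).trans_lt (hω n).lt_top

/-! ### Bounded support as finiteness of the mass of (1, ∞) -/

theorem measurableSet_gt (b : ℝ) : MeasurableSet {x : PosReal | b < (x : ℝ)} :=
  measurableSet_lt measurable_const measurable_subtype_coe

theorem IsBoundedRadonPoint.measure_gt_one_ne_top {m : Measure PosReal}
    (h : IsBoundedRadonPoint m) : m {x : PosReal | 1 < (x : ℝ)} ≠ ∞ := by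
  obtain ⟨b, hb⟩ := h.2
  have hK : IsCompact {x : PosReal | (x : ℝ) ∈ Set.Icc 1 b} := by
    rw [Subtype.isCompact_iff]
    convert! (isCompact_Icc : IsCompact (Set.Icc (1 : ℝ) b)) using 1
    ext y
    simp only [Set.mem_image, Set.mem_ofPred_eq, Subtype.exists, exists_and_right, exists_eq_right]
    exact ⟨fun h => h.2, fun h => ⟨lt_of_lt_of_le one_pos h.1, h⟩⟩
  refine ne_top_of_le_ne_top (ENNReal.add_ne_top.2 ⟨(h.1.2 _ hK).ne, hb.trans_ne
    ENNReal.zero_ne_top⟩) ((measure_mono fun x hx => ?_).trans (measure_union_le _ _))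
  rcases le_or_gt (x : ℝ) b with hxb | hxb
  · exact Or.inl ⟨(show 1 < (x : ℝ) from hx).le, hxb⟩
  · exact Or.inr hxb

/-- Each atom above 1 contributes mass one, so finite mass leaves finitely many of them and their
positions are bounded. -/
theorem IsRadonPoint.isBoundedRadonPoint {m : Measure PosReal} (h : IsRadonPoint m)
    (hfin : m {x : PosReal | 1 < (x : ℝ)} ≠ ∞) : IsBoundedRadonPoint m := by
  refine ⟨h, ?_⟩
  obtain ⟨κ, hκ, x, rfl⟩ := h.1
  have hd : ∀ (c : ℝ) k, Measure.dirac (x k) {y : PosReal | c < (y : ℝ)} =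
      {y : PosReal | c < (y : ℝ)}.indicator 1 (x k) := fun c k =>
    Measure.dirac_apply' _ (measurableSet_gt c)
  rw [Measure.sum_apply _ (measurableSet_gt 1)] at hfin
  have hf := ENNReal.finite_const_le_of_tsum_ne_top hfin one_ne_zero
  obtain ⟨b, hb⟩ := (hf.image fun k => (x k : ℝ)).bddAbove
  refine ⟨max 1 b, ?_⟩
  rw [Measure.sum_apply _ (measurableSet_gt _), ENNReal.tsum_eq_zero]
  intro k
  rw [hd, Set.indicator_of_notMem]
  intro hk
  have hk' : max 1 b < (x k : ℝ) := hk
  have h1 : (1 : ℝ≥0∞) ≤ Measure.dirac (x k) {y : PosReal | 1 < (y : ℝ)} := by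
    rw [hd, Set.indicator_of_mem]
    · rfl
    · exact (le_max_left _ _).trans_lt hk'
  exact absurd (hb ⟨k, h1, rfl⟩) (not_le.2 ((le_max_right _ _).trans_lt hk'))

theorem IsBoundedRadonPoint.statSum_of_isStationary (himm : IsImmigration X I P s τ ξ)
    (hsum : ∀ᵐ ω ∂P, ∀ t : ℝ≥0, IsRadonPoint (immigrantSum X τ ξ t ω))
    {π : Measure RadonPointMeasure} (hπ : IsStationary X τ ξ P π)
    (hb : ∀ᵐ u ∂π, IsBoundedRadonPoint u.toMeasure) :
    ∀ᵐ ω ∂P, IsBoundedRadonPoint (statSum X τ ξ ω) := by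
  have h1 := himm.ae_lintegral_statSum_ne_top hsum hπ
    (φ := {x : PosReal | 1 < (x : ℝ)}.indicator 1)
    (measurable_one.indicator (measurableSet_gt 1)) (by
      filter_upwards [hb] with u hu
      rw [lintegral_indicator_one (measurableSet_gt 1)]
      exact hu.measure_gt_one_ne_top)
  simp only [lintegral_indicator_one (measurableSet_gt 1)] at h1
  filter_upwards [h1, IsRadonPoint.statSum_of_isStationary himm hsum hπ] with ω h2 h3
  exact h3.isBoundedRadonPoint h2

/-! ### The law of the stationary sum -/

/-- After the factorization at time t, countable superposition identifies the first factor with the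
functional of X started from `statSum`. -/
theorem IsImmigration.isStationary_map_statSum (himm : IsImmigration X I P s τ ξ)
    (hX : X.Superposition)
    (hsum : ∀ᵐ ω ∂P, ∀ t : ℝ≥0, IsRadonPoint (immigrantSum X τ ξ t ω))
    (hstat : ∀ᵐ ω ∂P, IsRadonPoint (statSum X τ ξ ω)) :
    IsStationary X τ ξ P (P.map fun ω => RadonPointMeasure.ofMeasure (statSum X τ ξ ω)) := by
  have hτ := himm.measurable_time
  have hξ := himm.measurable
  have hm := himm.aemeasurable_ofMeasure_statSum hstat
  have hprob : IsProbabilityMeasure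
      (P.map fun ω => RadonPointMeasure.ofMeasure (statSum X τ ξ ω)) :=
    Measure.isProbabilityMeasure_map hm
  refine ⟨hprob, fun t => ?_⟩
  have := Measure.isProbabilityMeasure_map (aemeasurable_immigrationProc hsum
    (P.map fun ω => RadonPointMeasure.ofMeasure (statSum X τ ξ ω)) hτ hξ t)
  refine RadonPointMeasure.measure_ext_of_laplace fun φ hφ hc => ?_
  have hφm : Measurable fun x => (φ x : ℝ≥0∞) := hφ.measurable.coe_nnreal_ennreal
  have hg : Measurable fun u : RadonPointMeasure => negExp (∫⁻ x, φ x ∂u.toMeasure) :=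
    measurable_negExp.comp (RadonPointMeasure.measurable_lintegral hφm)
  rw [lintegral_negExp_immigrationProc hsum _ hτ hξ t hφm, himm.lintegral_negExp_immigrantSum hφm,
    lintegral_map' (X.measurable_laplace hφm t).aemeasurable hm, lintegral_map' hg.aemeasurable hm]
  have h1 : ∫⁻ ω, negExp (∫⁻ x, φ x ∂(RadonPointMeasure.ofMeasure
      (statSum X τ ξ ω)).toMeasure) ∂P = ∫⁻ ω, negExp (∫⁻ x, φ x ∂(statSum X τ ξ ω)) ∂P := by
    refine lintegral_congr_ae ?_
    filter_upwards [hstat] with ω hω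
    rw [RadonPointMeasure.toMeasure_ofMeasure hω]
  rw [h1, himm.lintegral_negExp_statSum_eq_mul hφm t]
  congr 1
  refine lintegral_congr_ae ?_
  filter_upwards [hstat] with ω hω
  exact X.laplace_sum hX hφ hc t (RadonPointMeasure.toMeasure_ofMeasure hω)

/-! ### Convergence in law -/

theorem MarkovProcess.TendstoZeroInProbability.exists_seq_tendsto_ae
    {π : Measure RadonPointMeasure} [IsProbabilityMeasure π]
    (h : X.TendstoZeroInProbability π) {t : ℕ → ℝ≥0} (ht : Tendsto t atTop atTop) :
    ∃ k : ℕ → ℕ, StrictMono k ∧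
      ∀ᵐ w ∂(X.lawFrom π), Tendsto (fun n => X.proc (t (k n)) w) atTop (𝓝 0) := by
  let := TopologicalSpace.pseudoMetrizableSpacePseudoMetric RadonPointMeasure
  refine TendstoInMeasure.exists_seq_tendsto_ae (f := fun n w => X.proc (t n) w)
    (g := fun _ => 0) fun ε hε => ?_
  refine ((h _ (Metric.eball_mem_nhds 0 hε)).comp ht).congr fun n => ?_
  simp [Metric.eball]

/-- The immigrant sum need not converge pathwise, whereas the truncated sum increases to `statSum`.
Exchanging them at each fixed time reduces convergence in law to almost sure convergence. -/
theorem IsImmigration.map_immigrationProc_eq (himm : IsImmigration X I P s τ ξ)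
    (hsum : ∀ᵐ ω ∂P, ∀ t : ℝ≥0, IsRadonPoint (immigrantSum X τ ξ t ω))
    (hstat : ∀ᵐ ω ∂P, IsRadonPoint (statSum X τ ξ ω)) (π : Measure RadonPointMeasure)
    [IsProbabilityMeasure π] (t : ℝ≥0) :
    AEMeasurable (fun p => X.proc t p.1 + RadonPointMeasure.ofMeasure (truncSum X τ ξ t p.2))
      (immigrationLaw X P π) ∧
    (immigrationLaw X P π).map (immigrationProc X τ ξ t) = (immigrationLaw X P π).map
      fun p => X.proc t p.1 + RadonPointMeasure.ofMeasure (truncSum X τ ξ t p.2) := by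
  have hτ := himm.measurable_time
  have hξ := himm.measurable
  have hradon : ∀ᵐ ω ∂P, IsRadonPoint (truncSum X τ ξ t ω) := by
    filter_upwards [hstat] with ω hω
    exact hω.of_le (isPointMeasure_truncSum X τ ξ t ω) (truncSum_le_statSum X τ ξ t ω)
  have hT : AEMeasurable (fun ω => RadonPointMeasure.ofMeasure (truncSum X τ ξ t ω)) P :=
    aemeasurable_ofMeasure (fun _ hφ =>
      (measurable_lintegral_truncSum hτ hξ hφ t).aemeasurable) hradon
  have hV : AEMeasurable (fun p => X.proc t p.1 +
      RadonPointMeasure.ofMeasure (truncSum X τ ξ t p.2)) (immigrationLaw X P π) :=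
    ((X.measurable_proc_at t).comp measurable_fst).aemeasurable.add hT.comp_snd
  refine ⟨hV, ?_⟩
  have := Measure.isProbabilityMeasure_map (aemeasurable_immigrationProc hsum π hτ hξ t)
  have := Measure.isProbabilityMeasure_map hV
  refine RadonPointMeasure.measure_ext_of_laplace fun φ hφ hc => ?_
  have hφm : Measurable fun x => (φ x : ℝ≥0∞) := hφ.measurable.coe_nnreal_ennreal
  have hg : Measurable fun u : RadonPointMeasure => negExp (∫⁻ x, φ x ∂u.toMeasure) :=
    measurable_negExp.comp (RadonPointMeasure.measurable_lintegral hφm)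
  have h1 : Measurable fun w => negExp (∫⁻ x, φ x ∂(X.proc t w).toMeasure) :=
    measurable_negExp.comp (X.measurable_lintegral_proc_at hφm t)
  rw [lintegral_negExp_immigrationProc hsum _ hτ hξ t hφm, himm.lintegral_negExp_immigrantSum hφm,
    lintegral_map' hg.aemeasurable hV]
  simp only [RadonPointMeasure.toMeasure_add, lintegral_add_measure, negExp_add]
  have h2 : AEMeasurable (fun ω => negExp (∫⁻ x, φ x ∂(RadonPointMeasure.ofMeasure
      (truncSum X τ ξ t ω)).toMeasure)) P := hg.comp_aemeasurable hT
  rw [lintegral_prod_mul h1.aemeasurable h2,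
    Measure.lintegral_bind X.law.aemeasurable h1.aemeasurable]
  congr 1
  refine lintegral_congr_ae ?_
  filter_upwards [hradon] with ω hω
  rw [RadonPointMeasure.toMeasure_ofMeasure hω]

theorem IsImmigration.tendstoInDistribution (himm : IsImmigration X I P s τ ξ)
    (hsum : ∀ᵐ ω ∂P, ∀ t : ℝ≥0, IsRadonPoint (immigrantSum X τ ξ t ω))
    (hstat : ∀ᵐ ω ∂P, IsRadonPoint (statSum X τ ξ ω)) (π : Measure RadonPointMeasure)
    [IsProbabilityMeasure π] (hπ : X.TendstoZeroInProbability π) :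
    TendstoInDistribution (fun t : ℝ≥0 => immigrationProc X τ ξ t) atTop
      (fun ω => RadonPointMeasure.ofMeasure (statSum X τ ξ ω))
      (fun _ => immigrationLaw X P π) P := by
  have hm := himm.aemeasurable_ofMeasure_statSum hstat
  refine ⟨fun t => aemeasurable_immigrationProc hsum π himm.measurable_time himm.measurable t,
    hm, ?_⟩
  refine ProbabilityMeasure.tendsto_iff_forall_integral_tendsto.2 fun f => ?_
  have hf : ∀ μ : Measure RadonPointMeasure, AEStronglyMeasurable f μ := fun μ =>
    f.continuous.measurable.aestronglyMeasurable
  simp only [ProbabilityMeasure.coe_mk]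
  simp_rw [fun t => (himm.map_immigrationProc_eq hsum hstat π t).2]
  rw [integral_map hm (hf _)]
  simp_rw [fun t => integral_map (himm.map_immigrationProc_eq hsum hstat π t).1 (hf _)]
  -- Convergence in probability yields almost sure convergence only along subsequences, which
  -- suffices for the convergence of integrals.
  refine tendsto_of_subseq_tendsto fun t ht => ?_
  obtain ⟨k, hk, hlim⟩ := hπ.exists_seq_tendsto_ae ht
  refine ⟨k, ?_⟩
  -- The limit is moved to the product space so that dominated convergence applies under one
  -- measure.
  have hsnd : ∫ ω, f (RadonPointMeasure.ofMeasure (statSum X τ ξ ω)) ∂P =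
      ∫ p, f (RadonPointMeasure.ofMeasure (statSum X τ ξ p.2)) ∂(immigrationLaw X P π) := by
    rw [integral_fun_snd (μ := X.lawFrom π) (ν := P)
      fun ω => f (RadonPointMeasure.ofMeasure (statSum X τ ξ ω))]
    simp
  rw [hsnd]
  refine tendsto_integral_of_dominated_convergence (fun _ => ‖f‖)
    (fun n => (hf _).comp_aemeasurable (himm.map_immigrationProc_eq hsum hstat π _).1)
    (integrable_const _) (fun n => ae_of_all _ fun p => f.norm_coe_le_norm _) ?_
  have h1 := (Measure.quasiMeasurePreserving_fst (μ := X.lawFrom π) (ν := P)).ae hlim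
  have h2 := (Measure.quasiMeasurePreserving_snd (μ := X.lawFrom π) (ν := P)).ae hstat
  filter_upwards [h1, h2] with p hp1 hp2
  refine (f.continuous.tendsto _).comp ?_
  have h3 := hp1.add ((tendsto_ofMeasure_truncSum hp2).comp (ht.comp hk.tendsto_atTop))
  have h4 : (0 : RadonPointMeasure) + RadonPointMeasure.ofMeasure (statSum X τ ξ p.2) =
      RadonPointMeasure.ofMeasure (statSum X τ ξ p.2) := by
    ext1; simp
  rw [h4] at h3
  exact h3

end

end Immigration

end


theorem lemma5 {W ι Ω : Type*} [MeasurableSpace W] [Countable ι] [MeasurableSpace Ω]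
    (X : Immigration.MarkovProcess W) (hX : X.Superposition)
    (I : Measure Immigration.RadonPointMeasure) [SigmaFinite I]
    (P : Measure Ω) [IsProbabilityMeasure P]
    (s : ι → Ω → Immigration.RadonPointMeasure) (τ : ι → Ω → ℝ≥0) (ξ : ι → Ω → W)
    (himm : Immigration.IsImmigration X I P s τ ξ)
    (hsum : ∀ᵐ ω ∂P, ∀ t : ℝ≥0, Immigration.IsRadonPoint (Immigration.immigrantSum X τ ξ t ω)) :
    ((∀ᵐ ω ∂P, Immigration.IsRadonPoint (Immigration.statSum X τ ξ ω)) →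
      Immigration.IsStationary X τ ξ P
        (P.map fun ω => Immigration.RadonPointMeasure.ofMeasure (Immigration.statSum X τ ξ ω)) ∧
      ∀ (π : Measure Immigration.RadonPointMeasure) [IsProbabilityMeasure π],
        X.TendstoZeroInProbability π →
        TendstoInDistribution (fun t : ℝ≥0 => Immigration.immigrationProc X τ ξ t) atTop
          (fun ω => Immigration.RadonPointMeasure.ofMeasure (Immigration.statSum X τ ξ ω))
          (fun _ => Immigration.immigrationLaw X P π) P) ∧
    (0 < P {ω | ¬ Immigration.IsRadonPoint (Immigration.statSum X τ ξ ω)} →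
      ¬ ∃ π : Measure Immigration.RadonPointMeasure, Immigration.IsStationary X τ ξ P π) ∧
    (0 < P {ω | ¬ Immigration.IsBoundedRadonPoint (Immigration.statSum X τ ξ ω)} →
      ¬ ∃ π : Measure Immigration.RadonPointMeasure, Immigration.IsStationary X τ ξ P π ∧
        ∀ᵐ u ∂π, Immigration.IsBoundedRadonPoint u.toMeasure) := by
  refine ⟨fun hstat => ⟨himm.isStationary_map_statSum hX hsum hstat, fun π _ hπ =>
    himm.tendstoInDistribution hsum hstat π hπ⟩, ?_, ?_⟩
  · rintro hpos ⟨π, hπ⟩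
    exact hpos.ne' (ae_iff.1 (Immigration.IsRadonPoint.statSum_of_isStationary himm hsum hπ))
  · rintro hpos ⟨π, hπ, hb⟩
    exact hpos.ne'
      (ae_iff.1 (Immigration.IsBoundedRadonPoint.statSum_of_isStationary himm hsum hπ hb))
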